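/- **Notions.** A *directed acyclic multigraph (DAMG)* $G=(V,E)$ consists of a finite set $V$ of vertices and a finite set $E$ of (possibly parallel) directed edges, each with a tail and a head in $V$, such that some total order of $V$ makes every edge go up. Let $E(x,y)$ be the set of edges from $x$ to $y$, $E(y)$ the set of edges with head $y$, $\mathcal R(G)$ the set of roots (vertices without incoming edges); leaves are the vertices without outgoing edges. Let $\pi^G(x,y)$ be the number of directed paths from $x$ to $y$ (the trivial path from $x$ to $x$ counts) and $\pi^G(y)=\sum_{r\in\mathcal R(G)}\pi^G(r,y)$. We write $x\in\mathrm{Anc}^G(y)$, equivalently $y\in\mathrm{Desc}^G(x)$, if there is a directed path from $x$ to $y$. Let $\mathbb Z_G\subseteq\mathbb Q$ be the subring generated by the fractions $\pi^G(x)/\pi^G(y)$ over all $x,y$ with $E(x,y)\neq\emptyset$; for $r\in\mathcal R(G)$ and $y\in V$ one has $\pi^G(r,y)/\pi^G(y)\in\mathbb Z_G$. Rings are commutative with one. For an abelian group $A$ and $v:V\to A$, the synergy function $v'_G:V\to A$ is defined recursively by $v'_G(x)=v(x)-\sum_{y\in\mathrm{Anc}^G(x)\setminus\{x\}}v'_G(y)$.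 A vertex $z$ is *weak* for $(G,v)$ if $v'_G(z)=0$; a root $r$ is a *null root* if $v'_G(x)=0$ for all $x\in\mathrm{Desc}^G(r)$. The unanimity game $\zeta_y$ is $1$ on $\mathrm{Desc}^G(y)$ and $0$ elsewhere. $G$ is *hierarchically flat* if every vertex is a root or a leaf. *Projections.* For $z\in V$, $G^{\setminus z}$ has vertex set $V\setminus\{z\}$, the edges of $G$ not touching $z$, and one new edge $e_1e_2:x\to y$ for each pair of edges $e_1:x\to z$, $e_2:z\to y$. Edge weights $q:E\to R$ in a ring $R$ project to $q^{\setminus z}(e)=q(e)$ and $q^{\setminus z}(e_1e_2)=q(e_1)q(e_2)$; a function $w:V\to A$ into an $R$-module projects to $w^{\setminus z}(x)=w(x)+q(x|z)\,w(z)$, where $q(x|z)=\sum_{e\in E(x,z)}q(e)$. For a set $S\subseteq V$, $G^{\setminus S}$, $q^{\setminus S}$, $w^{\setminus S}$ arise by projecting out the elements of $S$ one after the other (the order is irrelevant, up to canonical identification). For $v:V\to A$ with synergy function $w=v'_G$, put $v^{\setminus S}(y)=\sum_{x\in\mathrm{Anc}^{G^{\setminus S}}(y)}w^{\setminus S}(x)$.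 If $S$ contains no root, then $G^{\setminus S}$ has the same roots as $G$ and $\mathbb Z_{G^{\setminus S}}\subseteq\mathbb Z_G$. The weights $q$ are *normalized* if $\sum_{x\in V}q(x|y)=1$ for every non-root $y$; then the Shapley value of $v$ for $(G,q)$ is $\mathrm{Sh}^{(G,q)}_r(v)=(v'_G)^{\setminus(V\setminus\mathcal R(G))}(r)$, $r\in\mathcal R(G)$. The *path uniform weights* are $q_G(e)=\pi^G(x)/\pi^G(y)\in\mathbb Z_G$ for $e\in E(x,y)$. **Theorem.** Let $\mathrm{Sh}$ be a rule that assigns to every DAMG $G=(V,E)$, every $\mathbb Z_G$-module $A$, every $v:V\to A$ and every $r\in\mathcal R(G)$ a value $\mathrm{Sh}^G_r(v)\in A$. Assume, for all DAMGs $G=(V,E)$ and all $r\in\mathcal R(G)$: 1. *$A$-linearity*: for every $\mathbb Z_G$-algebra $R$, $R$-module $A$, finite set $I$, $a_i\in A$ and $v_i:V\to R$ ($i\in I$): $\mathrm{Sh}^G_r(\sum_i v_i\cdot a_i)=\sum_i\mathrm{Sh}^G_r(v_i)\cdot a_i$. 2. *Weak elements*: for every $\mathbb Z_G$-module $A$,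 $v:V\to A$ and set $W\subseteq V\setminus\mathcal R(G)$ of weak elements for $(G,v)$: $\mathrm{Sh}^G_r(v)=\mathrm{Sh}^{G^{\setminus W}}_r(v|_{V\setminus W})$. 3. *Flat hierarchy*: if $G$ is hierarchically flat and $y\in V$, then for $\zeta_y$ (as a $\mathbb Z_G$-valued function) $\mathrm{Sh}^G_r(\zeta_y)=\delta_{r,y}$ if $y$ is a root, and $\mathrm{Sh}^G_r(\zeta_y)=|E(r,y)|/|E(y)|$ otherwise. Then the following hold for all DAMGs $G=(V,E)$, $\mathbb Z_G$-modules $A$, $v:V\to A$ and $r\in\mathcal R(G)$: 4. *Explicit formula*: $\displaystyle\mathrm{Sh}^G_r(v)=\sum_{y\in V}\frac{\pi^G(r,y)}{\pi^G(y)}\cdot v'_G(y)$. 5. *Path uniform projection weights*: $q_G$ is normalized and $\mathrm{Sh}^G_r(v)=\mathrm{Sh}^{(G,q_G)}_r(v)$. 6. *$R$-linearity*: for every $\mathbb Z_G$-algebra $R$, every $R$-module $A$, $v_1,v_2:V\to A$ and $c_1,c_2\in R$: $\mathrm{Sh}^G_r(c_1v_1+c_2v_2)=c_1\mathrm{Sh}^G_r(v_1)+c_2\mathrm{Sh}^G_r(v_2)$.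 7. *Efficiency*: $\sum_{r\in\mathcal R(G)}\mathrm{Sh}^G_r(v)=\sum_{x\in V}v'_G(x)$. 8. *Null root*: $\mathrm{Sh}^G_r(v)=0$ if $r$ is a null root for $(G,v)$. 9. *Projection*: $\mathrm{Sh}^G_r(v)=\mathrm{Sh}^{G^{\setminus S}}_r(v^{\setminus S})$ for every $S\subseteq V\setminus\mathcal R(G)$, where $v^{\setminus S}$ is formed with respect to $q_G$. 10. *Symmetry*: for every DAMG automorphism $\alpha$ of $G$ (compatible bijections of $V$ and of $E$): $\mathrm{Sh}^G_{\alpha(r)}(v)=\mathrm{Sh}^G_r(v\circ\alpha)$; moreover, if $v'_G(\alpha(y))=v'_G(y)$ for all $y\in\mathrm{Desc}^G(r)$, then $\mathrm{Sh}^G_{\alpha(r)}(v)=\mathrm{Sh}^G_r(v)$. 11. *Boolean lattices*: let $I$ be a finite set, $A$ a $\mathbb Q$-vector space (for instance $\mathbb R$), $v:2^I\to A$ with $v(\emptyset)=0$, let $w$ be the synergy function of $v$ on the Hasse diagram of $2^I$, and let $G$ be the Hasse diagram of $2^I\setminus\{\emptyset\}$, whose roots are the singletons. Then for every $i\in I$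 $$\mathrm{Sh}^G_{\{i\}}(v)=\sum_{i\in y\subseteq I}\frac1{|y|}\,w(y)=\sum_{y\subseteq I\setminus\{i\}}\frac{|y|!\,(|I|-|y|-1)!}{|I|!}\,\bigl(v(y\cup\{i\})-v(y)\bigr).$$ Conversely, the rule defined by the explicit formula in 4 has all the properties 1–11. -/

import Mathlib

universe u w x

/-- A directed acyclic multigraph whose vertices are taken from an ambient type `α`: a finite set
of vertices, a finite type of (possibly parallel) edges with tail and head, and a topological
ordering, that is a total order on the vertices for which every edge goes up. -/
structure DAMG (α : Type u) where
  verts : Set α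
  finite_verts : verts.Finite
  E : Type u
  finite_E : Finite E
  tail : E → verts
  head : E → verts
  acyclic : ∃ _ : LinearOrder verts, ∀ e, tail e < head e

namespace DAMG

variable {α : Type u}

noncomputable instance instFintypeVerts (G : DAMG α) : Fintype G.verts :=
  G.finite_verts.fintype

noncomputable instance instFintypeE (G : DAMG α) : Fintype G.E :=
  @Fintype.ofFinite G.E G.finite_E

/-! ### Edges, paths, ancestors, roots and leaves -/

/-- The edges from `x` to `y`. -/
def edges (G : DAMG α) (x y : G.verts) : Set G.E := {e | G.tail e = x ∧ G.head e = y}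

/-- The edges with head `y`. -/
def edgesInto (G : DAMG α) (y : G.verts) : Set G.E := {e | G.head e = y}

/-- The vertices without parents. -/
def roots (G : DAMG α) : Set G.verts := {x | ∀ y, G.edges y x = ∅}

/-- The vertices without children. -/
def leaves (G : DAMG α) : Set G.verts := {x | ∀ y, G.edges x y = ∅}

/-- `G.IsPath x l y`: the list of edges `l` is a directed path from `x` to `y`.
The empty list is the trivial path from `x` to `x`. -/
def IsPath (G : DAMG α) : G.verts → List G.E → G.verts → Prop
  | x, [], y => x = y
  | x, e :: l, y => G.tail e = x ∧ G.IsPath (G.head e) l y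

/-- The set of directed paths from `x` to `y`. -/
def paths (G : DAMG α) (x y : G.verts) : Set (List G.E) := {l | G.IsPath x l y}

def anc (G : DAMG α) (x : G.verts) : Set G.verts := {y | (G.paths y x).Nonempty}

def desc (G : DAMG α) (x : G.verts) : Set G.verts := {y | (G.paths x y).Nonempty}

noncomputable instance instFintypeRoots (G : DAMG α) : Fintype G.roots :=
  (Set.toFinite G.roots).fintype

/-- `π(x, y)`, the number of directed paths from `x` to `y`. -/
noncomputable def pathCount (G : DAMG α) (x y : G.verts) : ℕ := (G.paths x y).ncard

/-- `π(y)`, the number of directed paths from any root to `y`. -/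
noncomputable def rootPathCount (G : DAMG α) (y : G.verts) : ℕ :=
  ∑ r : G.roots, G.pathCount r y

/-- Every vertex is a root or a leaf. -/
def HierarchicallyFlat (G : DAMG α) : Prop := ∀ y, y ∈ G.roots ∨ y ∈ G.leaves

/-! ### Basic facts on paths -/

theorem not_mem_roots_iff (G : DAMG α) (y : G.verts) : y ∉ G.roots ↔ ∃ e, G.head e = y := by
  simp only [roots, edges, Set.mem_ofPred_eq, Set.eq_empty_iff_forall_notMem]
  push Not
  constructor
  · rintro ⟨_, e, he⟩
    exact ⟨e, he.2⟩
  · rintro ⟨e, he⟩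
    exact ⟨_, e, rfl, he⟩

theorem isPath_append (G : DAMG α) {x y z : G.verts} {l m : List G.E} (h : G.IsPath x l y)
    (h' : G.IsPath y m z) : G.IsPath x (l ++ m) z := by
  induction l generalizing x with
  | nil => cases h; exact h'
  | cons e l ih => exact ⟨h.1, ih h.2⟩

theorem tail_ne_head (G : DAMG α) (e : G.E) : G.tail e ≠ G.head e := by
  obtain ⟨_, ho⟩ := G.acyclic
  exact (ho e).ne

/-- `y` is an ancestor of `x` different from `x`. -/
def StrictAnc (G : DAMG α) (y x : G.verts) : Prop := y ∈ G.anc x ∧ y ≠ x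

theorem le_of_isPath (G : DAMG α) (_ : LinearOrder G.verts) (ho : ∀ e, G.tail e < G.head e)
    {x y : G.verts} {l : List G.E} (h : G.IsPath x l y) :
    x ≤ y ∧ ∀ e ∈ l, x ≤ G.tail e := by
  induction l generalizing x with
  | nil => cases h; simp
  | cons e l ih =>
    obtain ⟨rfl, h⟩ := h
    obtain ⟨h1, h2⟩ := ih h
    refine ⟨(ho e).le.trans h1, ?_⟩
    intro e' he'
    rcases List.mem_cons.1 he' with rfl | he'
    · exact le_rfl
    · exact (ho e).le.trans (h2 e' he')

theorem strictAnc_wf (G : DAMG α) : WellFounded G.StrictAnc := by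
  obtain ⟨o, ho⟩ := G.acyclic
  refine Subrelation.wf (r := fun a b : G.verts => a < b) ?_ (Finite.to_wellFoundedLT).wf
  rintro y x ⟨⟨l, hl⟩, hne⟩
  exact lt_of_le_of_ne (G.le_of_isPath o ho hl).1 hne

theorem nodup_of_isPath (G : DAMG α) {x y : G.verts} {l : List G.E} (h : G.IsPath x l y) :
    l.Nodup := by
  obtain ⟨o, ho⟩ := G.acyclic
  induction l generalizing x with
  | nil => simp
  | cons e l ih =>
    refine List.nodup_cons.2 ⟨fun he => ?_, ih h.2⟩
    exact absurd ((G.le_of_isPath o ho h.2).2 e he) (not_le.2 (ho e))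

theorem paths_finite (G : DAMG α) (x y : G.verts) : (G.paths x y).Finite := by
  classical
  have : Finite {l : List G.E // l.Nodup} := inferInstance
  exact Set.Finite.subset (s := {l : List G.E | l.Nodup}) this fun l hl => G.nodup_of_isPath hl

theorem exists_root (G : DAMG α) (y : G.verts) : ∃ r : G.roots, (G.paths r y).Nonempty := by
  induction y using G.strictAnc_wf.induction with
  | _ y ih =>
    by_cases hy : y ∈ G.roots
    · exact ⟨⟨y, hy⟩, [], rfl⟩
    · obtain ⟨e, rfl⟩ := (G.not_mem_roots_iff y).1 hy
      have he : G.IsPath (G.tail e) [e] (G.head e) := ⟨rfl, rfl⟩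
      obtain ⟨r, l, hl⟩ := ih (G.tail e) ⟨⟨[e], Set.mem_ofPred.2 he⟩, G.tail_ne_head e⟩
      exact ⟨r, l ++ [e], G.isPath_append hl he⟩

theorem rootPathCount_pos (G : DAMG α) (y : G.verts) : 0 < G.rootPathCount y := by
  obtain ⟨r, hr⟩ := G.exists_root y
  exact Finset.sum_pos' (fun _ _ => Nat.zero_le _)
    ⟨r, Finset.mem_univ _, (Set.ncard_pos (G.paths_finite _ _)).2 hr⟩

theorem eq_nil_of_isPath_root (G : DAMG α) {x r : G.verts} (hr : r ∈ G.roots) {l : List G.E}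
    (h : G.IsPath x l r) : l = [] := by
  induction l generalizing x with
  | nil => rfl
  | cons e l ih =>
    have := ih h.2
    subst this
    exact absurd hr ((G.not_mem_roots_iff r).2 ⟨e, h.2⟩)

theorem rootPathCount_root (G : DAMG α) (r : G.roots) : G.rootPathCount r = 1 := by
  rw [rootPathCount, Finset.sum_eq_single r]
  · have : G.paths r r = {[]} := by
      ext l
      refine ⟨fun h => G.eq_nil_of_isPath_root r.2 h, ?_⟩
      rintro rfl
      exact rfl
    rw [pathCount, this, Set.ncard_singleton]
  · intro s _ hs
    have : G.paths s r = ∅ := by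
      ext l
      refine ⟨fun h => ?_, fun h => h.elim⟩
      have hl := G.eq_nil_of_isPath_root r.2 h
      subst hl
      exact hs (Subtype.ext h)
    rw [pathCount, this, Set.ncard_empty]
  · simp

/-! ### The coefficient ring and path shares -/

/-- The subring `ℤ_G` of `ℚ` generated by the fractions `π(x) / π(y)` over all edges from `x`
to `y`. -/
def ring (G : DAMG α) : Subring ℚ :=
  Subring.closure {c | ∃ e, c = (G.rootPathCount (G.tail e) : ℚ) / G.rootPathCount (G.head e)}

theorem div_mem_ring (G : DAMG α) (e : G.E) :
    (G.rootPathCount (G.tail e) : ℚ) / G.rootPathCount (G.head e) ∈ G.ring :=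
  Subring.subset_closure ⟨e, rfl⟩

theorem div_mem_ring_of_isPath (G : DAMG α) {x y : G.verts} {l : List G.E} (h : G.IsPath x l y) :
    (G.rootPathCount x : ℚ) / G.rootPathCount y ∈ G.ring := by
  have hpos : ∀ z, (G.rootPathCount z : ℚ) ≠ 0 := fun z =>
    Nat.cast_ne_zero.2 (G.rootPathCount_pos z).ne'
  induction l generalizing x with
  | nil =>
    cases h
    rw [div_self (hpos _)]
    exact G.ring.one_mem
  | cons e l ih =>
    obtain ⟨rfl, h⟩ := h
    have := G.ring.mul_mem (G.div_mem_ring e) (ih h)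
    rwa [div_mul_div_cancel₀ (hpos _)] at this

theorem share_mem_ring (G : DAMG α) (r : G.roots) (y : G.verts) :
    (G.pathCount r y : ℚ) / G.rootPathCount y ∈ G.ring := by
  by_cases h : (G.paths r y).Nonempty
  · obtain ⟨l, hl⟩ := h
    have := G.div_mem_ring_of_isPath hl
    rw [rootPathCount_root, Nat.cast_one] at this
    rw [div_eq_mul_one_div]
    exact G.ring.mul_mem (natCast_mem _ _) this
  · rw [pathCount, Set.not_nonempty_iff_eq_empty.1 h, Set.ncard_empty, Nat.cast_zero, zero_div]
    exact G.ring.zero_mem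

/-- The fraction `π(r, y) / π(y)`, which lies in `ℤ_G`. -/
noncomputable def share (G : DAMG α) (r : G.roots) (y : G.verts) : G.ring :=
  ⟨(G.pathCount r y : ℚ) / G.rootPathCount y, G.share_mem_ring r y⟩

/-! ### Möbius transform, unanimity games, weak and null elements -/

section Moebius

variable {A : Type w} [AddCommGroup A]

open Classical in
/-- The Möbius transform (synergy function) of `v`, defined recursively by
`v'(x) = v(x) - ∑ v'(y)`, the sum being over all ancestors `y ≠ x` of `x`. -/
noncomputable def moebius (G : DAMG α) (v : G.verts → A) (x : G.verts) : A :=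
  v x - ∑ y : {y // G.StrictAnc y x}, G.moebius v y.1
termination_by G.strictAnc_wf.wrap x
decreasing_by exact y.2

open Classical in
/-- The unanimity game centred at `y`. -/
noncomputable def unanimity (G : DAMG α) (R : Type w) [Zero R] [One R] (y x : G.verts) : R :=
  if x ∈ G.desc y then 1 else 0

def IsWeak (G : DAMG α) (v : G.verts → A) (z : G.verts) : Prop := G.moebius v z = 0

def IsNull (G : DAMG α) (v : G.verts → A) (y : G.verts) : Prop :=
  ∀ x ∈ G.desc y, G.moebius v x = 0

end Moebius

/-! ### Projections -/

/-- The projection of `G` onto the complement of `z`: the vertex `z` is removed, the edges between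
the other vertices are kept, and every pair of edges `a → z → b` gives a new edge `a → b`. -/
def proj (G : DAMG α) (z : α) : DAMG α where
  verts := G.verts \ {z}
  finite_verts := G.finite_verts.subset Set.sdiff_subset
  E := {e : G.E // (G.tail e : α) ≠ z ∧ (G.head e : α) ≠ z} ⊕
    {p : G.E × G.E // (G.tail p.1 : α) ≠ z ∧ (G.head p.1 : α) = z ∧
      (G.tail p.2 : α) = z ∧ (G.head p.2 : α) ≠ z}
  finite_E := inferInstance
  tail := Sum.elim (fun e => ⟨G.tail e.1, (G.tail e.1).2, e.2.1⟩)
    (fun p => ⟨G.tail p.1.1, (G.tail p.1.1).2, p.2.1⟩)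
  head := Sum.elim (fun e => ⟨G.head e.1, (G.head e.1).2, e.2.2⟩)
    (fun p => ⟨G.head p.1.2, (G.head p.1.2).2, p.2.2.2.2⟩)
  acyclic := by
    obtain ⟨o, ho⟩ := G.acyclic
    refine ⟨LinearOrder.lift' (fun x : (G.verts \ {z} : Set α) => (⟨x.1, x.2.1⟩ : G.verts))
      (fun a b h => Subtype.ext (Subtype.mk.inj h)), ?_⟩
    rintro (e | p)
    · exact ho e.1
    · have h : G.head p.1.1 = G.tail p.1.2 := Subtype.ext (p.2.2.1.trans p.2.2.2.1.symm)
      exact (ho p.1.1).trans (h ▸ ho p.1.2)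

/-- Iterated projection: the elements of the list are projected out one after the other. -/
def projList (G : DAMG α) : List α → DAMG α
  | [] => G
  | z :: l => (G.proj z).projList l

/-- `G^{∖S}`, the projection of `G` onto the complement of a set `S` of vertices: the elements of
`S` are projected out one after the other, along an enumeration of `S`. -/
noncomputable def projOut (G : DAMG α) (S : Finset G.verts) : DAMG α :=
  G.projList (S.toList.map Subtype.val)

theorem verts_projList (G : DAMG α) (l : List α) :
    (G.projList l).verts = G.verts \ {x | x ∈ l} := by
  induction l generalizing G with
  | nil => simp [projList]
  | cons z l ih =>
    rw [projList, ih]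
    ext x
    simp [proj, and_assoc]

theorem mem_verts_projOut (G : DAMG α) (S : Finset G.verts) (x : G.verts) :
    (x : α) ∈ (G.projOut S).verts ↔ x ∉ S := by
  simp [projOut, verts_projList]

theorem mem_of_mem_verts_projOut (G : DAMG α) (S : Finset G.verts) {x : α}
    (hx : x ∈ (G.projOut S).verts) : x ∈ G.verts := by
  rw [projOut, verts_projList] at hx
  exact hx.1

/-- The inclusion of the vertices of `G^{∖S}` into those of `G`. -/
def incl (G : DAMG α) (S : Finset G.verts) (x : (G.projOut S).verts) : G.verts :=
  ⟨x, G.mem_of_mem_verts_projOut S x.2⟩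

section ProjFacts

variable (G : DAMG α) (z : α)

/-- The inclusion of the vertices of `G^{∖z}` into those of `G`. -/
def inclOne (x : (G.proj z).verts) : G.verts := ⟨x, x.2.1⟩

theorem inclOne_injective : Function.Injective (G.inclOne z) := fun _ _ h =>
  Subtype.ext (congrArg Subtype.val h :)

theorem mem_roots_proj (hz : ∀ r ∈ G.roots, (r : α) ≠ z) (x : (G.proj z).verts) :
    x ∈ (G.proj z).roots ↔ G.inclOne z x ∈ G.roots := by
  rw [← not_iff_not, not_mem_roots_iff, not_mem_roots_iff]
  constructor
  · rintro ⟨e | p, rfl⟩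
    · exact ⟨e.1, rfl⟩
    · exact ⟨p.1.2, rfl⟩
  · rintro ⟨e, he⟩
    have hx : (G.head e : α) ≠ z := he ▸ x.2.2
    by_cases ht : (G.tail e : α) = z
    · have hn : G.tail e ∉ G.roots := fun h => hz _ h ht
      obtain ⟨e', he'⟩ := (G.not_mem_roots_iff _).1 hn
      have h1 : (G.head e' : α) = z := he' ▸ ht
      have h2 : (G.tail e' : α) ≠ z := fun h =>
        G.tail_ne_head e' (Subtype.ext (h.trans h1.symm))
      exact ⟨Sum.inr ⟨(e', e), h2, h1, ht, hx⟩, Subtype.ext (congrArg Subtype.val he :)⟩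
    · exact ⟨Sum.inl ⟨e, ht, hx⟩, Subtype.ext (congrArg Subtype.val he :)⟩

/-- The path of `G` that a path of `G^{∖z}` comes from. -/
def flatten : List (G.proj z).E → List G.E
  | [] => []
  | Sum.inl e :: l => e.1 :: flatten l
  | Sum.inr p :: l => p.1.1 :: p.1.2 :: flatten l

theorem flatten_injective : Function.Injective (G.flatten z) := by
  intro l
  induction l with
  | nil =>
    rintro (_ | ⟨_ | _, m⟩) h
    · rfl
    · simp [flatten] at h
    · simp [flatten] at h
  | cons a l ih =>
    rintro (_ | ⟨b, m⟩) h
    · rcases a with a | a <;> simp [flatten] at h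
    · rcases a with a | a <;> rcases b with b | b <;> simp only [flatten, List.cons.injEq] at h
      · rw [ih h.2, Subtype.ext h.1]
      · exact absurd (h.1 ▸ b.2.2.1) a.2.2
      · exact absurd (h.1 ▸ a.2.2.1) b.2.2
      · rw [ih h.2.2, Subtype.ext (Prod.ext h.1 h.2.1)]

theorem isPath_flatten {x y : (G.proj z).verts} {l : List (G.proj z).E}
    (h : (G.proj z).IsPath x l y) : G.IsPath (G.inclOne z x) (G.flatten z l) (G.inclOne z y) := by
  induction l generalizing x with
  | nil => cases h; exact rfl
  | cons a l ih =>
    obtain ⟨rfl, h⟩ := h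
    rcases a with a | p
    · exact ⟨rfl, ih h⟩
    · exact ⟨rfl, Subtype.ext (p.2.2.2.1.trans p.2.2.1.symm), ih h⟩

theorem exists_flatten : ∀ (m : List G.E) (x y : (G.proj z).verts),
    G.IsPath (G.inclOne z x) m (G.inclOne z y) →
    ∃ l, (G.proj z).IsPath x l y ∧ G.flatten z l = m
  | [], x, y, h => ⟨[], G.inclOne_injective z h, rfl⟩
  | [e], x, y, h => by
    have ht : (G.tail e : α) ≠ z := h.1 ▸ x.2.2
    have h2 : G.head e = G.inclOne z y := h.2
    have hh : (G.head e : α) ≠ z := h2 ▸ y.2.2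
    exact ⟨[Sum.inl ⟨e, ht, hh⟩], ⟨Subtype.ext (congrArg Subtype.val h.1 :),
      Subtype.ext (congrArg Subtype.val h2 :)⟩, rfl⟩
  | e :: e' :: m, x, y, h => by
    have ht : (G.tail e : α) ≠ z := h.1 ▸ x.2.2
    by_cases hh : (G.head e : α) = z
    · have ht' : (G.tail e' : α) = z := h.2.1 ▸ hh
      have hh' : (G.head e' : α) ≠ z := fun hc =>
        G.tail_ne_head e' (Subtype.ext (ht'.trans hc.symm))
      obtain ⟨l, hl, rfl⟩ := exists_flatten m ⟨G.head e', (G.head e').2, hh'⟩ y h.2.2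
      exact ⟨Sum.inr ⟨(e, e'), ht, hh, ht', hh'⟩ :: l,
        ⟨Subtype.ext (congrArg Subtype.val h.1 :), hl⟩, rfl⟩
    · obtain ⟨l, hl, hm⟩ := exists_flatten (e' :: m) ⟨G.head e, (G.head e).2, hh⟩ y h.2
      exact ⟨Sum.inl ⟨e, ht, hh⟩ :: l, ⟨Subtype.ext (congrArg Subtype.val h.1 :), hl⟩, by
        simp only [flatten, hm]⟩

theorem pathCount_proj (x y : (G.proj z).verts) :
    (G.proj z).pathCount x y = G.pathCount (G.inclOne z x) (G.inclOne z y) := by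
  have : G.paths (G.inclOne z x) (G.inclOne z y) = G.flatten z '' (G.proj z).paths x y := by
    ext m
    constructor
    · exact fun h => G.exists_flatten z m x y h
    · rintro ⟨l, hl, rfl⟩
      exact G.isPath_flatten z hl
  rw [pathCount, pathCount, this, Set.ncard_image_of_injective _ (G.flatten_injective z)]

theorem rootPathCount_proj (hz : ∀ r ∈ G.roots, (r : α) ≠ z) (y : (G.proj z).verts) :
    (G.proj z).rootPathCount y = G.rootPathCount (G.inclOne z y) := by
  refine Fintype.sum_bijective
    (fun r : (G.proj z).roots =>
      (⟨G.inclOne z r.1, (G.mem_roots_proj z hz r.1).1 r.2⟩ : G.roots)) ⟨?_, ?_⟩ _ _ ?_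
  · intro a b h
    exact Subtype.ext (G.inclOne_injective z (congrArg Subtype.val h :))
  · intro r
    exact ⟨⟨⟨r.1.1, r.1.2, hz r.1 r.2⟩, (G.mem_roots_proj z hz _).2 r.2⟩, rfl⟩
  · intro r
    exact G.pathCount_proj z r.1 y

theorem ring_proj_le (hz : ∀ r ∈ G.roots, (r : α) ≠ z) : (G.proj z).ring ≤ G.ring := by
  refine Subring.closure_le.2 ?_
  rintro _ ⟨e, rfl⟩
  rw [rootPathCount_proj G z hz, rootPathCount_proj G z hz]
  have h : (G.proj z).IsPath ((G.proj z).tail e) [e] ((G.proj z).head e) := ⟨rfl, rfl⟩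
  exact G.div_mem_ring_of_isPath (G.isPath_flatten z h)

end ProjFacts

theorem projList_facts (G : DAMG α) (l : List α) (hl : ∀ z ∈ l, ∀ r ∈ G.roots, (r : α) ≠ z) :
    (G.projList l).ring ≤ G.ring ∧
      ∀ (r : α) (h : r ∈ G.verts) (h' : r ∈ (G.projList l).verts), (⟨r, h⟩ : G.verts) ∈ G.roots →
        (⟨r, h'⟩ : (G.projList l).verts) ∈ (G.projList l).roots := by
  induction l generalizing G with
  | nil => exact ⟨le_rfl, fun r h _ hr => hr⟩
  | cons z l ih =>
    have hz := hl z (by simp)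
    obtain ⟨h1, h2⟩ := ih (G.proj z) (fun z' hz' r hr =>
      hl z' (by simp [hz']) _ ((G.mem_roots_proj z hz r).1 hr))
    refine ⟨h1.trans (G.ring_proj_le z hz), fun r h h' hr => ?_⟩
    exact h2 r ⟨h, hz _ hr⟩ h' ((G.mem_roots_proj z hz _).2 hr)

theorem projOut_aux (G : DAMG α) (S : Finset G.verts) (hS : ∀ s ∈ S, s ∉ G.roots) :
    ∀ z ∈ S.toList.map Subtype.val, ∀ r ∈ G.roots, (r : α) ≠ z := by
  intro z hz r hr h
  obtain ⟨s, hs, rfl⟩ := List.mem_map.1 hz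
  exact hS s (Finset.mem_toList.1 hs) (Subtype.ext h ▸ hr)

/-- `ℤ_{G^{∖S}} ⊆ ℤ_G` if `S` contains no root. -/
theorem ring_projOut_le (G : DAMG α) (S : Finset G.verts) (hS : ∀ s ∈ S, s ∉ G.roots) :
    (G.projOut S).ring ≤ G.ring :=
  (G.projList_facts _ (G.projOut_aux S hS)).1

/-- A root of `G` as a vertex of `G^{∖S}`, if `S` contains no root. -/
noncomputable def rootVertex (G : DAMG α) (S : Finset G.verts) (hS : ∀ s ∈ S, s ∉ G.roots) (r : G.roots) :
    (G.projOut S).verts :=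
  ⟨r.1, (G.mem_verts_projOut S r.1).2 fun h => hS _ h r.2⟩

/-- A root of `G` as a root of `G^{∖S}`, if `S` contains no root. -/
noncomputable def rootLift (G : DAMG α) (S : Finset G.verts) (hS : ∀ s ∈ S, s ∉ G.roots) (r : G.roots) :
    (G.projOut S).roots :=
  ⟨G.rootVertex S hS r,
    (G.projList_facts _ (G.projOut_aux S hS)).2 r.1 r.1.2 (G.rootVertex S hS r).2 r.2⟩

/-- A `ℤ_G`-module as a `ℤ_{G^{∖S}}`-module, by restriction of scalars. -/
noncomputable abbrev projModule (G : DAMG α) (S : Finset G.verts) (hS : ∀ s ∈ S, s ∉ G.roots) (A : Type w)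
    [AddCommGroup A] [Module G.ring A] : Module (G.projOut S).ring A :=
  Module.compHom A (Subring.inclusion (G.ring_projOut_le S hS))

/-! ### Projection weights and Shapley values for given projection weights -/

section Weights

variable {R : Type x} [CommRing R] {A : Type w} [AddCommGroup A] [Module R A]

open Classical in
/-- The pairwise weight `q(x|y)`, the sum of `q` over all edges from `x` to `y`. -/
noncomputable def pairWeight (G : DAMG α) (q : G.E → R) (x y : G.verts) : R :=
  ∑ e with e ∈ G.edges x y, q e

/-- The weights entering each non-root sum to one. -/
def IsNormalized (G : DAMG α) (q : G.E → R) : Prop :=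
  ∀ y, y ∉ G.roots → ∑ x, G.pairWeight q x y = 1

/-- The projection `q^{∖z}` of edge weights. -/
def projWeight (G : DAMG α) (q : G.E → R) (z : α) : (G.proj z).E → R :=
  Sum.elim (fun e => q e.1) (fun p => q p.1.1 * q p.1.2)

open Classical in
/-- The projection `w^{∖z}(x) = w(x) + q(x|z) w(z)` of a synergy function. -/
noncomputable def projSynergy (G : DAMG α) (q : G.E → R) (w : G.verts → A) (z : α)
    (x : (G.proj z).verts) : A :=
  w (G.inclOne z x) +
    if hz : z ∈ G.verts then G.pairWeight q (G.inclOne z x) ⟨z, hz⟩ • w ⟨z, hz⟩ else 0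

/-- The iterated projection of a synergy function. -/
noncomputable def projListSynergy : (l : List α) → (G : DAMG α) → (G.E → R) → (G.verts → A) →
    (G.projList l).verts → A
  | [], _, _, w => w
  | z :: l, G, q, w => projListSynergy l (G.proj z) (G.projWeight q z) (G.projSynergy q w z)

/-- The projection `w^{∖S}` of a synergy function. -/
noncomputable def projOutSynergy (G : DAMG α) (q : G.E → R) (w : G.verts → A)
    (S : Finset G.verts) : (G.projOut S).verts → A :=
  projListSynergy (S.toList.map Subtype.val) G q w

open Classical in
/-- The projection `v^{∖S}` of a value function. -/
noncomputable def projOutValue (G : DAMG α) (q : G.E → R) (v : G.verts → A)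
    (S : Finset G.verts) (y : (G.projOut S).verts) : A :=
  ∑ x with x ∈ (G.projOut S).anc y, G.projOutSynergy q (G.moebius v) S x

open Classical in
noncomputable def nonRoots (G : DAMG α) : Finset G.verts := {x | x ∉ G.roots}

theorem not_mem_roots_of_mem_nonRoots (G : DAMG α) : ∀ s ∈ G.nonRoots, s ∉ G.roots := by
  simp [nonRoots]

/-- The Shapley value for given projection weights `q`: the synergy function of `v` is projected
onto the set of roots. -/
noncomputable def shapleyOfWeights (G : DAMG α) (q : G.E → R) (v : G.verts → A)
    (r : G.roots) : A :=
  G.projOutSynergy q (G.moebius v) G.nonRoots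
    (G.rootVertex G.nonRoots G.not_mem_roots_of_mem_nonRoots r)

end Weights

/-- The path uniform weights `π(x) / π(y)` for an edge from `x` to `y`. -/
noncomputable def pathUniform (G : DAMG α) (e : G.E) : G.ring :=
  ⟨(G.rootPathCount (G.tail e) : ℚ) / G.rootPathCount (G.head e), G.div_mem_ring e⟩

/-! ### Automorphisms -/

structure Automorphism (G : DAMG α) where
  onVerts : Equiv.Perm G.verts
  onEdges : Equiv.Perm G.E
  tail_eq : ∀ e, G.tail (onEdges e) = onVerts (G.tail e)
  head_eq : ∀ e, G.head (onEdges e) = onVerts (G.head e)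

theorem Automorphism.mem_roots {G : DAMG α} (φ : G.Automorphism) (r : G.roots) :
    φ.onVerts r ∈ G.roots := by
  by_contra h
  obtain ⟨e, he⟩ := (G.not_mem_roots_iff _).1 h
  refine (G.not_mem_roots_iff r.1).2 ⟨φ.onEdges.symm e, ?_⟩ r.2
  apply φ.onVerts.injective
  rw [← φ.head_eq, Equiv.apply_symm_apply, he]

def Automorphism.onRoots {G : DAMG α} (φ : G.Automorphism) (r : G.roots) : G.roots :=
  ⟨φ.onVerts r, φ.mem_roots r⟩

/-! ### Hasse diagrams -/

/-- The Hasse diagram of a finite subset `s` of a poset, with the induced order. -/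
noncomputable def hasse [PartialOrder α] (s : Set α) (hs : s.Finite) : DAMG α where
  verts := s
  finite_verts := hs
  E := {p : s × s // p.1 < p.2 ∧ ¬∃ z : s, p.1 < z ∧ z < p.2}
  finite_E := by
    have : Finite s := hs
    infer_instance
  tail p := p.1.1
  head p := p.1.2
  acyclic := by
    refine ⟨inferInstanceAs (LinearOrder (LinearExtension s)), ?_⟩
    rintro ⟨⟨a, b⟩, hab, _⟩
    exact lt_of_le_of_ne ((toLinearExtension (α := s)).monotone hab.le) hab.ne

/-- The Hasse diagram of all subsets of `I`. -/
noncomputable def subsets (I : Type u) [Fintype I] : DAMG (Finset I) :=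
  hasse Set.univ Set.finite_univ

/-- The Hasse diagram of all non-empty subsets of `I`. -/
noncomputable def nonemptySubsets (I : Type u) [Fintype I] : DAMG (Finset I) :=
  hasse {y | y ≠ ∅} (Set.toFinite _)

/-- The player `i`, that is the root `{i}` of the diagram of non-empty subsets. -/
noncomputable def player {I : Type u} [Fintype I] (i : I) : (nonemptySubsets I).roots :=
  ⟨⟨{i}, Finset.singleton_ne_empty i⟩, by
    by_contra h
    obtain ⟨⟨⟨a, b⟩, hab, _⟩, he⟩ := (not_mem_roots_iff _ _).1 h
    have hb : b = ⟨{i}, Finset.singleton_ne_empty i⟩ := he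
    have : a.1 ⊂ {i} := by
      have h' : a.1 < b.1 := hab
      rw [hb] at h'
      exact h'
    exact a.2 (Finset.ssubset_singleton_iff.1 this)⟩

end DAMG

/-! ### Assignment rules and their properties -/

/-- An assignment rule: for every DAMG `G`, every `ℤ_G`-module `A`, every value function
`v : V → A` and every root `r` of `G` a value `Sh G A v r` in `A`. -/
abbrev AssignmentRule : Type (max (u + 1) (w + 1)) :=
  ∀ ⦃α : Type u⦄ (G : DAMG α) (A : Type w) [AddCommGroup A] [Module G.ring A],
    (G.verts → A) → G.roots → A

namespace AssignmentRule

def ALinearity (Sh : AssignmentRule.{u, w}) : Prop :=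
  ∀ (α : Type u) (G : DAMG α) (R : Type w) [CommRing R] [Algebra G.ring R]
    (A : Type w) [AddCommGroup A] [Module R A] [Module G.ring A] [IsScalarTower G.ring R A]
    (n : ℕ) (a : Fin n → A) (v : Fin n → G.verts → R) (r : G.roots),
    Sh G A (fun x => ∑ i, v i x • a i) r = ∑ i, Sh G R (v i) r • a i

def WeakElements (Sh : AssignmentRule.{u, w}) : Prop :=
  ∀ (α : Type u) (G : DAMG α) (A : Type w) [AddCommGroup A] [Module G.ring A]
    (v : G.verts → A) (W : Finset G.verts) (hW : ∀ z ∈ W, z ∉ G.roots),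
    (∀ z ∈ W, G.IsWeak v z) → ∀ r : G.roots,
      letI := G.projModule W hW A
      Sh G A v r = Sh (G.projOut W) A (fun x => v (G.incl W x)) (G.rootLift W hW r)

open Classical in
/-- The values of the unanimity games are taken in `ℤ_G`, lifted to the universe of the modules. -/
def FlatHierarchy (Sh : AssignmentRule.{u, w}) : Prop :=
  ∀ (α : Type u) (G : DAMG α), G.HierarchicallyFlat → ∀ (y : G.verts) (r : G.roots),
    ((Sh G (ULift.{w} G.ring) (G.unanimity _ y) r).down : ℚ) =
      if y ∈ G.roots then (if (r : G.verts) = y then 1 else 0)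
      else ((G.edges r y).ncard : ℚ) / (G.edgesInto y).ncard

def ExplicitFormula (Sh : AssignmentRule.{u, w}) : Prop :=
  ∀ (α : Type u) (G : DAMG α) (A : Type w) [AddCommGroup A] [Module G.ring A]
    (v : G.verts → A) (r : G.roots),
    Sh G A v r = ∑ y, G.share r y • G.moebius v y

def PathUniformWeights (Sh : AssignmentRule.{u, w}) : Prop :=
  ∀ (α : Type u) (G : DAMG α), G.IsNormalized G.pathUniform ∧
    ∀ (A : Type w) [AddCommGroup A] [Module G.ring A] (v : G.verts → A) (r : G.roots),
      Sh G A v r = G.shapleyOfWeights G.pathUniform v r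

def RLinearity (Sh : AssignmentRule.{u, w}) : Prop :=
  ∀ (α : Type u) (G : DAMG α) (R : Type x) [CommRing R] [Algebra G.ring R]
    (A : Type w) [AddCommGroup A] [Module R A] [Module G.ring A] [IsScalarTower G.ring R A]
    (v₁ v₂ : G.verts → A) (c₁ c₂ : R) (r : G.roots),
    Sh G A (c₁ • v₁ + c₂ • v₂) r = c₁ • Sh G A v₁ r + c₂ • Sh G A v₂ r

def Efficiency (Sh : AssignmentRule.{u, w}) : Prop :=
  ∀ (α : Type u) (G : DAMG α) (A : Type w) [AddCommGroup A] [Module G.ring A]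
    (v : G.verts → A), ∑ r, Sh G A v r = ∑ y, G.moebius v y

def NullRoot (Sh : AssignmentRule.{u, w}) : Prop :=
  ∀ (α : Type u) (G : DAMG α) (A : Type w) [AddCommGroup A] [Module G.ring A]
    (v : G.verts → A) (r : G.roots), G.IsNull v r → Sh G A v r = 0

def Projection (Sh : AssignmentRule.{u, w}) : Prop :=
  ∀ (α : Type u) (G : DAMG α) (A : Type w) [AddCommGroup A] [Module G.ring A]
    (v : G.verts → A) (S : Finset G.verts) (hS : ∀ z ∈ S, z ∉ G.roots) (r : G.roots),
    letI := G.projModule S hS A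
    Sh G A v r = Sh (G.projOut S) A (G.projOutValue G.pathUniform v S) (G.rootLift S hS r)

def Symmetry (Sh : AssignmentRule.{u, w}) : Prop :=
  ∀ (α : Type u) (G : DAMG α) (A : Type w) [AddCommGroup A] [Module G.ring A]
    (v : G.verts → A) (φ : G.Automorphism) (r : G.roots),
    Sh G A v (φ.onRoots r) = Sh G A (fun y => v (φ.onVerts y)) r ∧
      ((∀ y ∈ G.desc r, G.moebius v (φ.onVerts y) = G.moebius v y) →
        Sh G A v (φ.onRoots r) = Sh G A v r)

open Classical in
/-- For a game `v` on the subsets of a finite set `I` with `v ∅ = 0`, the value of player `i` is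
given by Shapley's formula in terms of the Möbius transform of `v` on the lattice of all subsets,
and by Shapley's formula in terms of the marginal contributions of `i`. -/
def RecoversShapley (Sh : AssignmentRule.{u, w}) : Prop :=
  ∀ (I : Type u) [Fintype I] (A : Type w) [AddCommGroup A] [Module ℚ A] (v : Finset I → A),
    v ∅ = 0 → ∀ i : I,
      Sh (DAMG.nonemptySubsets I) A (fun y => v y.1) (DAMG.player i) =
          ∑ y : Finset I with i ∈ y, (1 / (y.card : ℚ)) •
            (DAMG.subsets I).moebius (fun z => v z.1) ⟨y, Set.mem_univ y⟩ ∧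
        Sh (DAMG.nonemptySubsets I) A (fun y => v y.1) (DAMG.player i) =
          ∑ y : Finset I with i ∉ y,
            ((y.card.factorial * (Fintype.card I - y.card - 1).factorial : ℚ) /
              (Fintype.card I).factorial) • (v (insert i y) - v y)

/-- The rule given by the explicit formula. -/
noncomputable def explicit : AssignmentRule.{u, w} :=
  fun _ G _ _ _ v r => ∑ y, G.share r y • G.moebius v y

end AssignmentRule

/-! Uniqueness: Möbius inversion writes `v` as the sum of the unanimity games `ζ_y` with
coefficients `v'(y)` (`sum_unanimity_smul`), so `A`-linearity reduces everything to the values of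
the `ζ_y`. The synergy function of `ζ_y` is concentrated at `y`, hence every non-root other than `y`
is weak and can be projected out. What remains is flat, and the flat axiom gives `|E(r,y)| / |E(y)|`
there. Paths of a projection correspond to the paths of `G` between surviving vertices, so edges
from roots to `y` in the flat graph count paths in `G`, and the quotient is `π(r,y) / π(y)`
(`unanimity_eq_share`).

Consequences: the shares `y ↦ π(r,y) / π(y)` are harmonic at every non-root: each is the average of
the shares of the parents, weighted by `q_G` (`share_eq_sum`). Projecting out `z` hands `w(z)` to
its parents in the proportions `q(x|z)`, so a sum weighted by a function harmonic at `z` is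
unchanged, and harmonicity survives the projection (`sum_smul_projSynergy`, `IsHarmonicAt.proj`).
This gives the projection property and, when only roots are left, the description by path uniform
weights. Efficiency holds because the shares of a vertex sum to one, the null root property because
shares vanish outside the descendants, and symmetry because automorphisms preserve path counts.

On non-empty subsets, paths are orders of adding elements, so the share of `i` in `y ∋ i` is `(|y| -
1)! / |y|! = 1 / |y|`; a hockey-stick identity converts this into the formula with marginal
contributions. -/

namespace DAMG
variable {α : Type u}

/-! ### Counting paths -/

theorem isPath_concat (G : DAMG α) {x y : G.verts} {l : List G.E} {e : G.E} :
    G.IsPath x (l ++ [e]) y ↔ G.IsPath x l (G.tail e) ∧ G.head e = y := by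
  induction l generalizing x with
  | nil => simp [IsPath, eq_comm]
  | cons a l ih => simp [IsPath, ih, and_assoc]

theorem pathCount_ne_zero_iff (G : DAMG α) {x y : G.verts} :
    G.pathCount x y ≠ 0 ↔ (G.paths x y).Nonempty := by
  rw [pathCount, ← Nat.pos_iff_ne_zero, Set.ncard_pos (G.paths_finite x y)]

theorem mem_anc_iff (G : DAMG α) {x y : G.verts} : y ∈ G.anc x ↔ G.pathCount y x ≠ 0 :=
  G.pathCount_ne_zero_iff.symm

theorem mem_desc_iff (G : DAMG α) {x y : G.verts} : y ∈ G.desc x ↔ G.pathCount x y ≠ 0 :=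
  G.pathCount_ne_zero_iff.symm

theorem mem_anc_self (G : DAMG α) (x : G.verts) : x ∈ G.anc x :=
  ⟨[], (rfl : x = x)⟩

theorem pathCount_self (G : DAMG α) (x : G.verts) : G.pathCount x x = 1 := by
  have : G.paths x x = {[]} := by
    ext l
    constructor
    · intro h
      rcases l with _ | ⟨e, l⟩
      · rfl
      · obtain ⟨o, ho⟩ := G.acyclic
        obtain ⟨rfl, h⟩ := h
        exact absurd (G.le_of_isPath o ho h).1 (not_le.2 (ho e))
    · rintro rfl
      exact (rfl : x = x)
  rw [pathCount, this, Set.ncard_singleton]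

open Classical in
/-- A path to a vertex different from its starting point is determined by its last edge and the
path to the tail of this edge. -/
theorem pathCount_eq_sum (G : DAMG α) {x y : G.verts} (hxy : x ≠ y) :
    G.pathCount x y = ∑ e with G.head e = y, G.pathCount x (G.tail e) := by
  let f : (Σ e : {e // G.head e = y}, G.paths x (G.tail e)) → G.paths x y :=
    fun p => ⟨p.2.1 ++ [p.1.1], G.isPath_concat.2 ⟨p.2.2, p.1.2⟩⟩
  have hf : Function.Bijective f := by
    constructor
    · rintro ⟨⟨e, he⟩, l, hl⟩ ⟨⟨e', he'⟩, l', hl'⟩ h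
      obtain ⟨h1, h2⟩ := List.append_inj' (congrArg Subtype.val h :) rfl
      obtain rfl : e = e' := by simpa using h2
      obtain rfl : l = l' := h1
      rfl
    · rintro ⟨l, hl⟩
      rcases List.eq_nil_or_concat l with rfl | ⟨l, e, rfl⟩
      · exact absurd hl hxy
      · have hl' : G.IsPath x (l ++ [e]) y := List.concat_eq_append ▸ hl
        have h := G.isPath_concat.1 hl'
        exact ⟨⟨⟨e, h.2⟩, l, h.1⟩, Subtype.ext List.concat_eq_append.symm⟩
  have hfin : ∀ e, Finite (G.paths x (G.tail e)) := fun e => G.paths_finite _ _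
  rw [pathCount, ← Nat.card_coe_set_eq, ← Nat.card_congr (Equiv.ofBijective f hf),
    Nat.card_sigma (α := {e // G.head e = y}) (β := fun e => G.paths x (G.tail e))]
  simp only [Nat.card_coe_set_eq]
  exact (Finset.sum_subtype _ (by simp) fun e => G.pathCount x (G.tail e)).symm

open Classical in
theorem rootPathCount_eq_sum (G : DAMG α) {y : G.verts} (hy : y ∉ G.roots) :
    G.rootPathCount y = ∑ e with G.head e = y, G.rootPathCount (G.tail e) := by
  simp only [rootPathCount]
  rw [Finset.sum_comm]
  exact Finset.sum_congr rfl fun r _ => G.pathCount_eq_sum fun h => hy (h ▸ r.2)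

theorem pathCount_of_mem_roots (G : DAMG α) {x y : G.verts} (hy : y ∈ G.roots) (hxy : x ≠ y) :
    G.pathCount x y = 0 := by
  by_contra h
  obtain ⟨l, hl⟩ := G.pathCount_ne_zero_iff.1 h
  obtain rfl := G.eq_nil_of_isPath_root hy hl
  exact hxy hl

theorem rootPathCount_ne_zero (G : DAMG α) (y : G.verts) : (G.rootPathCount y : ℚ) ≠ 0 :=
  Nat.cast_ne_zero.2 (G.rootPathCount_pos y).ne'

/-! ### Shares -/

theorem coe_share (G : DAMG α) (r : G.roots) (y : G.verts) :
    (G.share r y : ℚ) = G.pathCount r y / G.rootPathCount y := rfl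

theorem share_eq_zero (G : DAMG α) {r : G.roots} {y : G.verts} (h : y ∉ G.desc r) :
    G.share r y = 0 := by
  rw [mem_desc_iff, not_not] at h
  exact Subtype.ext (by simp [coe_share, h])

theorem share_self (G : DAMG α) (r : G.roots) : G.share r r = 1 :=
  Subtype.ext (by simp [coe_share, pathCount_self, rootPathCount_root])

theorem share_root_of_ne (G : DAMG α) {r : G.roots} {y : G.verts} (hy : y ∈ G.roots)
    (h : (r : G.verts) ≠ y) : G.share r y = 0 :=
  Subtype.ext (by simp [coe_share, G.pathCount_of_mem_roots hy h])

theorem sum_share (G : DAMG α) (y : G.verts) : ∑ r, G.share r y = 1 := by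
  apply Subtype.ext
  push_cast
  simp only [coe_share]
  rw [← Finset.sum_div, ← Nat.cast_sum]
  exact div_self (G.rootPathCount_ne_zero y)

open Classical in
/-- The share of a root in a non-root is the average of its shares in the parents with respect to
the path uniform weights. -/
theorem share_eq_sum (G : DAMG α) (r : G.roots) {y : G.verts} (hy : y ∉ G.roots) :
    G.share r y = ∑ e with G.head e = y, G.share r (G.tail e) * G.pathUniform e := by
  apply Subtype.ext
  push_cast
  rw [coe_share, G.pathCount_eq_sum fun h : r.1 = y => hy (h ▸ r.2), Nat.cast_sum, Finset.sum_div]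
  refine Finset.sum_congr rfl fun e he => ?_
  rw [← (Finset.mem_filter.1 he).2]
  exact (div_mul_div_cancel₀ (G.rootPathCount_ne_zero _)).symm

-- Groups the edges into `y` by their tails. This links the pairwise weights in `IsNormalized` and
-- `projSynergy` with the edge sums in `IsHarmonicAt`.
open Classical in
theorem sum_pairWeight {R : Type x} [CommRing R] (G : DAMG α) (q : G.E → R) (c : G.verts → R)
    (y : G.verts) :
    ∑ x, c x * G.pairWeight q x y = ∑ e with G.head e = y, c (G.tail e) * q e := by
  rw [← Finset.sum_fiberwise _ G.tail]
  refine Finset.sum_congr rfl fun x _ => ?_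
  rw [pairWeight, Finset.mul_sum, Finset.filter_filter]
  refine Finset.sum_congr (Finset.filter_congr fun e _ => and_comm) fun e he => ?_
  rw [((Finset.mem_filter.1 he).2).2]

/-- This is the recursion `rootPathCount_eq_sum` divided by `π(y)`. -/
theorem isNormalized_pathUniform (G : DAMG α) : G.IsNormalized G.pathUniform := by
  classical
  intro y hy
  have h := G.sum_pairWeight G.pathUniform (fun _ => 1) y
  simp only [one_mul] at h
  rw [h]
  apply Subtype.ext
  push_cast
  have : ∀ e ∈ Finset.univ.filter (fun e => G.head e = y), (G.pathUniform e : ℚ) =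
      (G.rootPathCount (G.tail e) : ℚ) / G.rootPathCount y := by
    intro e he
    rw [← (Finset.mem_filter.1 he).2]
    rfl
  rw [Finset.sum_congr rfl this, ← Finset.sum_div, ← Nat.cast_sum, ← G.rootPathCount_eq_sum hy]
  exact div_self (G.rootPathCount_ne_zero y)

/-! ### The Möbius transform -/

section Moebius

variable {A : Type w} [AddCommGroup A]

open Classical in
theorem sum_strictAnc (G : DAMG α) (w : G.verts → A) (x : G.verts) :
    ∑ y with y ∈ G.anc x, w y = w x + ∑ y : {y // G.StrictAnc y x}, w y.1 := by
  rw [← Finset.sum_subtype (Finset.univ.filter fun y => G.StrictAnc y x) (by simp) w,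
    ← Finset.add_sum_erase _ w (a := x) (by simp [mem_anc_self])]
  congr 2
  ext y
  simp [StrictAnc, and_comm]

open Classical in
/-- Möbius inversion. -/
theorem sum_moebius (G : DAMG α) (v : G.verts → A) (x : G.verts) :
    ∑ y with y ∈ G.anc x, G.moebius v y = v x := by
  rw [sum_strictAnc, moebius]
  exact sub_add_cancel _ _

-- Induction along strict ancestors. Möbius transforms are computed below by guessing `w` and
-- checking its sums over ancestors.
open Classical in
theorem moebius_eq_of_sum (G : DAMG α) {v w : G.verts → A}
    (h : ∀ x, ∑ y with y ∈ G.anc x, w y = v x) : G.moebius v = w := by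
  funext x
  induction x using G.strictAnc_wf.induction with
  | _ x ih =>
    rw [moebius, ← h x, sum_strictAnc, Finset.sum_congr rfl fun y _ => (ih y.1 y.2).symm]
    exact add_sub_cancel_right _ _

theorem moebius_sum (G : DAMG α) {ι : Type*} (s : Finset ι) (v : ι → G.verts → A) :
    G.moebius (fun x => ∑ i ∈ s, v i x) = fun x => ∑ i ∈ s, G.moebius (v i) x := by
  classical
  refine G.moebius_eq_of_sum fun x => ?_
  rw [Finset.sum_comm]
  exact Finset.sum_congr rfl fun i _ => G.sum_moebius _ _

theorem moebius_add (G : DAMG α) (v w : G.verts → A) :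
    G.moebius (v + w) = G.moebius v + G.moebius w := by
  classical
  refine G.moebius_eq_of_sum fun x => ?_
  simp only [Pi.add_apply, Finset.sum_add_distrib, sum_moebius]

/-- Serves both for multiplication by a fixed scalar and for `s ↦ s • a` with a fixed module element
`a`. -/
theorem moebius_map {B : Type*} [AddCommGroup B] (G : DAMG α) (f : A →+ B) (v : G.verts → A) :
    G.moebius (fun x => f (v x)) = fun x => f (G.moebius v x) := by
  classical
  refine G.moebius_eq_of_sum fun x => ?_
  rw [← map_sum, sum_moebius]

open Classical in
theorem moebius_unanimity (G : DAMG α) (R : Type w) [Ring R] (y : G.verts) :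
    G.moebius (G.unanimity R y) = fun x => if x = y then 1 else 0 := by
  refine G.moebius_eq_of_sum fun x => ?_
  rw [Finset.sum_ite_eq']
  simp only [Finset.mem_filter, Finset.mem_univ, true_and]
  rfl

/-- Every value function is a combination of unanimity games. -/
theorem sum_unanimity_smul {R : Type x} [Ring R] [Module R A] (G : DAMG α) (v : G.verts → A)
    (x : G.verts) : ∑ y, G.unanimity R y x • G.moebius v y = v x := by
  classical
  rw [← G.sum_moebius v x, Finset.sum_filter]
  refine Finset.sum_congr rfl fun y _ => ?_
  simp only [unanimity, ite_smul, one_smul, zero_smul]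
  rfl

end Moebius

/-! ### Iterated projections -/

/-- The inclusion of the vertices of an iterated projection. -/
def inclList (G : DAMG α) (l : List α) (x : (G.projList l).verts) : G.verts :=
  ⟨x, ((G.verts_projList l ▸ x.2 : (x : α) ∈ G.verts \ {x | x ∈ l})).1⟩

theorem inclList_injective (G : DAMG α) (l : List α) : Function.Injective (G.inclList l) :=
  fun _ _ h => Subtype.ext (congrArg Subtype.val h :)

theorem incl_injective (G : DAMG α) (S : Finset G.verts) : Function.Injective (G.incl S) :=
  G.inclList_injective _

theorem incl_notMem (G : DAMG α) (S : Finset G.verts) (x : (G.projOut S).verts) :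
    G.incl S x ∉ S :=
  (G.mem_verts_projOut S (G.incl S x)).1 x.2

theorem incl_surjOn (G : DAMG α) (S : Finset G.verts) {x : G.verts} (hx : x ∉ S) :
    ∃ y, G.incl S y = x :=
  ⟨⟨x, (G.mem_verts_projOut S x).2 hx⟩, rfl⟩

theorem pathCount_projList (G : DAMG α) (l : List α) (x y : (G.projList l).verts) :
    (G.projList l).pathCount x y = G.pathCount (G.inclList l x) (G.inclList l y) := by
  induction l generalizing G with
  | nil => rfl
  | cons z l ih => exact (ih (G.proj z) x y).trans (G.pathCount_proj z _ _)

theorem rootPathCount_projList (G : DAMG α) (l : List α)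
    (hl : ∀ z ∈ l, ∀ r ∈ G.roots, (r : α) ≠ z) (y : (G.projList l).verts) :
    (G.projList l).rootPathCount y = G.rootPathCount (G.inclList l y) := by
  induction l generalizing G with
  | nil => rfl
  | cons z l ih =>
    have hz := hl z (by simp)
    exact (ih (G.proj z) (fun z' hz' r hr =>
      hl z' (by simp [hz']) _ ((G.mem_roots_proj z hz r).1 hr)) y).trans
      (G.rootPathCount_proj z hz _)

theorem mem_roots_projList (G : DAMG α) (l : List α)
    (hl : ∀ z ∈ l, ∀ r ∈ G.roots, (r : α) ≠ z) (x : (G.projList l).verts) :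
    x ∈ (G.projList l).roots ↔ G.inclList l x ∈ G.roots := by
  induction l generalizing G with
  | nil => rfl
  | cons z l ih =>
    have hz := hl z (by simp)
    exact (ih (G.proj z) (fun z' hz' r hr =>
      hl z' (by simp [hz']) _ ((G.mem_roots_proj z hz r).1 hr)) x).trans
      (G.mem_roots_proj z hz _)

theorem pathCount_projOut (G : DAMG α) (S : Finset G.verts) (x y : (G.projOut S).verts) :
    (G.projOut S).pathCount x y = G.pathCount (G.incl S x) (G.incl S y) :=
  G.pathCount_projList _ x y

theorem rootPathCount_projOut (G : DAMG α) (S : Finset G.verts) (hS : ∀ s ∈ S, s ∉ G.roots)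
    (y : (G.projOut S).verts) :
    (G.projOut S).rootPathCount y = G.rootPathCount (G.incl S y) :=
  G.rootPathCount_projList _ (G.projOut_aux S hS) y

theorem mem_anc_projOut (G : DAMG α) (S : Finset G.verts) {x y : (G.projOut S).verts} :
    y ∈ (G.projOut S).anc x ↔ G.incl S y ∈ G.anc (G.incl S x) := by
  rw [mem_anc_iff, mem_anc_iff, pathCount_projOut]

theorem mem_roots_projOut (G : DAMG α) (S : Finset G.verts) (hS : ∀ s ∈ S, s ∉ G.roots)
    {x : (G.projOut S).verts} : x ∈ (G.projOut S).roots ↔ G.incl S x ∈ G.roots :=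
  G.mem_roots_projList _ (G.projOut_aux S hS) x

/-- Both path counts survive the projection, so the two fractions are the same rational number; the
inclusion of coefficient rings only makes them comparable. -/
theorem share_projOut (G : DAMG α) (S : Finset G.verts) (hS : ∀ s ∈ S, s ∉ G.roots)
    (r : G.roots) (y : (G.projOut S).verts) :
    Subring.inclusion (G.ring_projOut_le S hS) ((G.projOut S).share (G.rootLift S hS r) y) =
      G.share r (G.incl S y) := by
  apply Subtype.ext
  change ((G.projOut S).share (G.rootLift S hS r) y : ℚ) = G.share r (G.incl S y)
  rw [coe_share, pathCount_projOut, rootPathCount_projOut G S hS]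
  rfl

theorem sum_projOut_of_eq_zero {A : Type w} [AddCommMonoid A] (G : DAMG α) (S : Finset G.verts)
    (f : G.verts → A) (hf : ∀ z ∈ S, f z = 0) :
    ∑ x, f (G.incl S x) = ∑ x, f x :=
  (Fintype.sum_of_injective (G.incl S) (G.incl_injective S) _ _ (fun x hx => hf x (by
    by_contra h
    obtain ⟨y, rfl⟩ := G.incl_surjOn S h
    exact hx ⟨y, rfl⟩)) fun _ => rfl)

/-- Projecting out weak elements does not change the synergies of the other elements. -/
theorem moebius_projOut_of_isWeak {A : Type w} [AddCommGroup A] (G : DAMG α) (v : G.verts → A)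
    (W : Finset G.verts) (hW : ∀ z ∈ W, G.IsWeak v z) :
    (G.projOut W).moebius (fun x => v (G.incl W x)) = fun x => G.moebius v (G.incl W x) := by
  classical
  refine (G.projOut W).moebius_eq_of_sum fun x => ?_
  rw [← G.sum_moebius v, Finset.sum_filter, Finset.sum_filter,
    ← G.sum_projOut_of_eq_zero W _ fun z hz => ?_]
  · simp only [mem_anc_projOut]
  · rw [hW z hz, ite_self]

/-! ### Projected synergies -/

section Harmonic

variable {R : Type x} [CommRing R] {A : Type w} [AddCommGroup A] [Module R A]

open Classical in
/-- A function on the vertices is harmonic at `y` with respect to edge weights `q` if its value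
is the `q`-weighted sum of the values at the parents. -/
def IsHarmonicAt (G : DAMG α) (q : G.E → R) (c : G.verts → R) (y : G.verts) : Prop :=
  c y = ∑ e with G.head e = y, c (G.tail e) * q e

-- An edge of `G^{∖z}` into `y` is sorted by its last edge `e` in `G`: if `e` starts at `z`, it is
-- preceded by some edge into `z`, and otherwise it stands alone.
open Classical in
theorem sum_proj_edges {M : Type*} [AddCommMonoid M] (G : DAMG α) (z : G.verts)
    (f : (G.proj z).E → M) (g : G.E → M) (h : G.E → G.E → M) (y : (G.proj z).verts)
    (hg : ∀ e, f (Sum.inl e) = g e.1) (hh : ∀ p, f (Sum.inr p) = h p.1.1 p.1.2) :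
    ∑ e with (G.proj z).head e = y, f e =
      ∑ e with G.head e = G.inclOne z y, if G.tail e = z then
        ∑ e' with G.head e' = z, h e' e else g e := by
  -- The edges of `G.proj z` carry the `Fintype` structure obtained from finiteness, not that of a
  -- sum type; the two agree by uniqueness.
  have hsum : ∀ F : (G.proj z).E → M,
      ∑ e, F e = ∑ e, F (Sum.inl e) + ∑ p, F (Sum.inr p) := fun F => by
    refine Eq.trans ?_ (Fintype.sum_sum_type F)
    exact congrArg (fun i : Fintype (G.proj z).E => ∑ e ∈ @Finset.univ _ i, F e)
      (Subsingleton.elim _ _)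
  have hy : (y : α) ≠ z := y.2.2
  have h1 : ∀ e, (G.proj z).head (Sum.inl e) = y ↔ G.head e.1 = G.inclOne z y := fun e => by
    rw [Subtype.ext_iff, Subtype.ext_iff]; rfl
  have h2 : ∀ p, (G.proj z).head (Sum.inr p) = y ↔ G.head p.1.2 = G.inclOne z y := fun e => by
    rw [Subtype.ext_iff, Subtype.ext_iff]; rfl
  have h3 : ∀ e, G.head e = G.inclOne z y → (G.head e : α) ≠ z := fun e he => he ▸ hy
  rw [Finset.sum_filter, hsum]
  simp only [h1, h2, hg, hh]
  rw [← Finset.sum_subtype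
      (Finset.univ.filter fun e => (G.tail e : α) ≠ z ∧ (G.head e : α) ≠ z) (by simp)
      (fun e => if G.head e = G.inclOne z y then g e else 0),
    ← Finset.sum_subtype
      (Finset.univ.filter fun p : G.E × G.E => (G.tail p.1 : α) ≠ z ∧ (G.head p.1 : α) = z ∧
        (G.tail p.2 : α) = z ∧ (G.head p.2 : α) ≠ z) (by simp)
      (fun p => if G.head p.2 = G.inclOne z y then h p.1 p.2 else 0),
    Finset.sum_filter, Finset.sum_filter, Finset.sum_filter, Fintype.sum_prod_type_right,
    ← Finset.sum_add_distrib]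
  refine Finset.sum_congr rfl fun e _ => ?_
  by_cases he : G.head e = G.inclOne z y
  · have := h3 e he
    by_cases ht : G.tail e = z
    · simp only [he, if_true, ht, ne_eq, not_true_eq_false, false_and, if_false, zero_add,
        true_and, Finset.sum_filter]
      refine Finset.sum_congr rfl fun e' _ => ?_
      by_cases he' : G.head e' = z
      · have h4 : (G.tail e' : α) ≠ z := fun h => G.tail_ne_head e' (Subtype.ext (h.trans
          (congrArg Subtype.val he'.symm)))
        rw [he] at this
        simp [he', h4, this]
      · simp [he', Subtype.ext_iff.not.1 he']
    · have ht' := Subtype.ext_iff.not.1 ht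
      simp [he, ht, ht', he ▸ this]
  · simp [he]

/-- In the harmonic equation at `y`, each occurrence of `c z` is replaced by its own harmonic
expansion; the products `q e' * q e` that appear are the weights of the new edges. -/
theorem IsHarmonicAt.proj {G : DAMG α} {q : G.E → R} {c : G.verts → R} {z : G.verts}
    (hz : G.IsHarmonicAt q c z) {y : (G.proj z).verts} (hy : G.IsHarmonicAt q c (G.inclOne z y)) :
    (G.proj z).IsHarmonicAt (G.projWeight q z) (fun x => c (G.inclOne z x)) y := by
  unfold IsHarmonicAt at hy ⊢
  rw [G.sum_proj_edges z _ (fun e => c (G.tail e) * q e)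
    (fun e' e => c (G.tail e') * (q e' * q e)) y (fun e => rfl) fun p => rfl]
  refine hy.trans (Finset.sum_congr rfl fun e _ => ?_)
  split_ifs with h
  · rw [h, hz, Finset.sum_mul]
    exact Finset.sum_congr rfl fun e' _ => mul_assoc _ _ _
  · rfl

theorem sum_inclOne_add {M : Type*} [AddCommMonoid M] (G : DAMG α) (z : G.verts)
    (f : G.verts → M) : ∑ x, f (G.inclOne z x) + f z = ∑ x, f x := by
  classical
  rw [add_comm, ← Finset.add_sum_erase _ f (Finset.mem_univ z)]
  congr 1
  refine Finset.sum_bij (fun x _ => G.inclOne z x) (fun x _ => ?_)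
    (fun x _ y _ h => G.inclOne_injective z h) (fun x hx => ?_) fun _ _ => rfl
  · exact Finset.mem_erase.2 ⟨fun h => x.2.2 (congrArg Subtype.val h :), Finset.mem_univ _⟩
  · exact ⟨⟨x, x.2, fun h => (Finset.mem_erase.1 hx).1 (Subtype.ext h)⟩, Finset.mem_univ _, rfl⟩

theorem pairWeight_self (G : DAMG α) (q : G.E → R) (x : G.verts) : G.pairWeight q x x = 0 := by
  classical
  rw [pairWeight]
  refine Finset.sum_eq_zero fun e he => ?_
  obtain ⟨h1, h2⟩ := (Finset.mem_filter.1 he).2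
  exact absurd (h1.trans h2.symm) (G.tail_ne_head e)

/-- After the projection `w z` enters with total coefficient `∑ c(x) q(x|z)`, which harmonicity
identifies with `c z`, its coefficient before. -/
theorem sum_smul_projSynergy {G : DAMG α} {q : G.E → R} {c : G.verts → R} (w : G.verts → A)
    {z : G.verts} (hz : G.IsHarmonicAt q c z) :
    ∑ x, c (G.inclOne z x) • G.projSynergy q w z x = ∑ x, c x • w x := by
  -- The formula for the projected synergy is extended to `x = z`, where `q(z|z) = 0` leaves `c z •
  -- w z`; this cancels against the redistributed mass on the right.
  have h := G.sum_inclOne_add z fun x => c x • w x + (c x * G.pairWeight q x z) • w z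
  have h' : ∑ x, c x * G.pairWeight q x z = c z := (G.sum_pairWeight q c z).trans hz.symm
  simp only [pairWeight_self, mul_zero, zero_smul, add_zero] at h
  rw [Finset.sum_add_distrib (f := fun x => c x • w x), ← Finset.sum_smul, h'] at h
  rw [← add_right_cancel h]
  refine Finset.sum_congr rfl fun x _ => ?_
  simp only [projSynergy, z.2, dif_pos, smul_add, mul_smul]

/-- If `c` is harmonic at the elements that are projected out, then the sum of the synergies
weighted by `c` does not change. -/
theorem sum_smul_projListSynergy (l : List α) (G : DAMG α) (q : G.E → R) (c : G.verts → R)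
    (w : G.verts → A) (hl : l.Nodup) (hG : ∀ z ∈ l, ∃ h : z ∈ G.verts, G.IsHarmonicAt q c ⟨z, h⟩) :
    ∑ x, c (G.inclList l x) • projListSynergy l G q w x = ∑ x, c x • w x := by
  induction l generalizing G with
  | nil => rfl
  | cons z l ih =>
    obtain ⟨hz, hl⟩ := List.nodup_cons.1 hl
    obtain ⟨hzG, hc⟩ := hG z (by simp)
    refine (ih (G.proj z) (G.projWeight q z) (fun x => c (G.inclOne z x)) (G.projSynergy q w z) hl
      fun y hy => ?_).trans (sum_smul_projSynergy (z := ⟨z, hzG⟩) w hc)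
    obtain ⟨h, hcy⟩ := hG y (by simp [hy])
    exact ⟨⟨h, fun h' => hz (h' ▸ hy)⟩, IsHarmonicAt.proj (z := ⟨z, hzG⟩) hc hcy⟩

theorem sum_smul_projOutSynergy (G : DAMG α) (q : G.E → R) (c : G.verts → R)
    (w : G.verts → A) (S : Finset G.verts) (hS : ∀ z ∈ S, G.IsHarmonicAt q c z) :
    ∑ x, c (G.incl S x) • G.projOutSynergy q w S x = ∑ x, c x • w x := by
  refine sum_smul_projListSynergy _ G q c w (S.nodup_toList.map Subtype.val_injective)
    fun z hz => ?_
  obtain ⟨s, hs, rfl⟩ := List.mem_map.1 hz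
  exact ⟨s.2, hS s (Finset.mem_toList.1 hs)⟩

end Harmonic

theorem isHarmonicAt_share (G : DAMG α) (r : G.roots) {y : G.verts} (hy : y ∉ G.roots) :
    G.IsHarmonicAt G.pathUniform (G.share r) y :=
  G.share_eq_sum r hy

theorem mem_nonRoots (G : DAMG α) {x : G.verts} : x ∈ G.nonRoots ↔ x ∉ G.roots := by
  simp [nonRoots]

/-! ### Flat hierarchies -/

theorem HierarchicallyFlat.tail_mem_roots {G : DAMG α} (hG : G.HierarchicallyFlat) (e : G.E) :
    G.tail e ∈ G.roots := by
  refine (hG (G.tail e)).resolve_right fun h => ?_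
  have : e ∈ G.edges (G.tail e) (G.head e) := ⟨rfl, rfl⟩
  rw [h] at this
  exact this

/-- In a flat hierarchy, paths from a root to a non-root are edges. -/
theorem HierarchicallyFlat.pathCount_eq {G : DAMG α} (hG : G.HierarchicallyFlat) {x y : G.verts}
    (hx : x ∈ G.roots) (hy : y ∉ G.roots) : G.pathCount x y = (G.edges x y).ncard := by
  classical
  rw [G.pathCount_eq_sum fun h : x = y => hy (h ▸ hx)]
  have key : ∀ e, G.pathCount x (G.tail e) = if G.tail e = x then 1 else 0 := fun e => by
    split_ifs with h
    · rw [h, pathCount_self]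
    · exact G.pathCount_of_mem_roots (hG.tail_mem_roots e) (Ne.symm h)
  simp only [key]
  rw [← Finset.card_filter, Finset.filter_filter, ← Set.ncard_coe_finset]
  congr 1
  ext e
  simp [edges, and_comm]

theorem HierarchicallyFlat.rootPathCount_eq {G : DAMG α} (hG : G.HierarchicallyFlat)
    {y : G.verts} (hy : y ∉ G.roots) : G.rootPathCount y = (G.edgesInto y).ncard := by
  classical
  rw [G.rootPathCount_eq_sum hy, Finset.sum_congr rfl fun e _ =>
    G.rootPathCount_root ⟨_, hG.tail_mem_roots e⟩, Finset.sum_const, smul_eq_mul, mul_one,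
    ← Set.ncard_coe_finset]
  congr 1
  ext e
  simp [edgesInto]

-- Identifies the share with the value prescribed by `FlatHierarchy`, both to verify that axiom and
-- to use it for uniqueness.
open Classical in
theorem HierarchicallyFlat.coe_share {G : DAMG α} (hG : G.HierarchicallyFlat) (r : G.roots)
    (y : G.verts) : (G.share r y : ℚ) = if y ∈ G.roots then (if (r : G.verts) = y then 1 else 0)
      else ((G.edges r y).ncard : ℚ) / (G.edgesInto y).ncard := by
  split_ifs with hy hr
  · subst hr
    rw [share_self, OneMemClass.coe_one]
  · rw [G.share_root_of_ne hy hr, ZeroMemClass.coe_zero]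
  · rw [DAMG.coe_share, hG.pathCount_eq r.2 hy, hG.rootPathCount_eq hy]

end DAMG

/-! ### Consequences of the explicit formula -/

namespace AssignmentRule
open DAMG

variable {Sh : AssignmentRule.{u, w}}

theorem ExplicitFormula.aLinearity (h : Sh.ExplicitFormula) : Sh.ALinearity := by
  intro α G R _ _ A _ _ _ _ n a v r
  have key : G.moebius (fun x => ∑ i, v i x • a i) = fun y => ∑ i, G.moebius (v i) y • a i := by
    rw [G.moebius_sum]
    funext y
    exact Finset.sum_congr rfl fun i _ =>
      congrFun (G.moebius_map ((AddMonoidHom.flip (smulAddHom R A)) (a i)) (v i)) y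
  rw [h, key]
  simp only [h α G R, Finset.sum_smul, Finset.smul_sum, smul_assoc]
  exact Finset.sum_comm

/-- Weak vertices contribute zero terms, while the synergies and shares of the remaining vertices do
not change. -/
theorem ExplicitFormula.weakElements (h : Sh.ExplicitFormula) : Sh.WeakElements := by
  intro α G A _ _ v W hW hv r
  let := G.projModule W hW A
  change Sh G A v r = Sh (G.projOut W) A (fun x => v (G.incl W x)) (G.rootLift W hW r)
  rw [h, h, G.moebius_projOut_of_isWeak v W hv, ← G.sum_projOut_of_eq_zero W _ fun z hz => ?_]
  · refine Finset.sum_congr rfl fun x _ => ?_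
    rw [← G.share_projOut W hW]
    rfl
  · rw [hv z hz, smul_zero]

theorem ExplicitFormula.unanimity (h : Sh.ExplicitFormula) {α : Type u} (G : DAMG α) (y : G.verts)
    (r : G.roots) : (Sh G (ULift.{w} G.ring) (G.unanimity _ y) r).down = G.share r y := by
  classical
  rw [h, G.moebius_unanimity]
  simp

theorem ExplicitFormula.flatHierarchy (h : Sh.ExplicitFormula) : Sh.FlatHierarchy := by
  intro α G hG y r
  rw [h.unanimity, hG.coe_share]

/-- A sum of projected synergies, weighted by the shares of a root. -/
theorem sum_share_smul_projOutSynergy {α : Type u} (G : DAMG α) {A : Type w} [AddCommGroup A]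
    [Module G.ring A] (w : G.verts → A) (S : Finset G.verts) (hS : ∀ z ∈ S, z ∉ G.roots)
    (r : G.roots) :
    ∑ x, G.share r (G.incl S x) • G.projOutSynergy G.pathUniform w S x =
      ∑ x, G.share r x • w x :=
  G.sum_smul_projOutSynergy _ _ w S fun z hz => G.isHarmonicAt_share r (hS z hz)

theorem ExplicitFormula.projection (h : Sh.ExplicitFormula) : Sh.Projection := by
  classical
  intro α G A _ _ v S hS r
  let := G.projModule S hS A
  change Sh G A v r = Sh (G.projOut S) A (G.projOutValue G.pathUniform v S) (G.rootLift S hS r)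
  -- The projected value function is by definition the ancestor sum of the projected synergies, so
  -- Möbius inversion returns these.
  have key : (G.projOut S).moebius (G.projOutValue G.pathUniform v S) =
      G.projOutSynergy G.pathUniform (G.moebius v) S :=
    (G.projOut S).moebius_eq_of_sum fun x => rfl
  rw [h, h, key, ← sum_share_smul_projOutSynergy G _ S hS]
  refine Finset.sum_congr rfl fun x _ => ?_
  rw [← G.share_projOut S hS]
  rfl

theorem ExplicitFormula.pathUniformWeights (h : Sh.ExplicitFormula) : Sh.PathUniformWeights := by
  intro α G
  refine ⟨G.isNormalized_pathUniform, fun A _ _ v r => ?_⟩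
  have hS := G.not_mem_roots_of_mem_nonRoots
  -- Only roots survive, and on roots the share of `r` is a Kronecker delta.
  rw [h, ← sum_share_smul_projOutSynergy G _ _ hS, Finset.sum_eq_single (G.rootVertex _ hS r)]
  · have : G.share r (G.incl _ (G.rootVertex _ hS r)) = 1 := G.share_self r
    rw [this, one_smul]
    rfl
  · intro x _ hx
    have hx' : G.incl _ x ∈ G.roots := by
      by_contra hr
      exact G.incl_notMem G.nonRoots x (G.mem_nonRoots.2 hr)
    rw [G.share_root_of_ne hx', zero_smul]
    exact fun hr => hx (Subtype.ext (congrArg Subtype.val hr.symm :))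
  · simp

theorem ExplicitFormula.rLinearity (h : Sh.ExplicitFormula) :
    AssignmentRule.RLinearity.{u, w, x} Sh := by
  intro α G R _ _ A _ _ _ _ v₁ v₂ c₁ c₂ r
  have key : ∀ (c : R) (v : G.verts → A), G.moebius (c • v) = c • G.moebius v := fun c v =>
    G.moebius_map (DistribSMul.toAddMonoidHom A c) v
  -- `ℤ_G` acts on `A` through the commutative ring `R`.
  have hc : ∀ (c : R) (s : G.ring) (a : A), s • c • a = c • s • a := fun c s a => by
    rw [← algebraMap_smul R s, ← algebraMap_smul R s, smul_comm]
  rw [h, h, h, G.moebius_add, key, key]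
  simp only [Pi.add_apply, Pi.smul_apply, smul_add, Finset.sum_add_distrib, Finset.smul_sum, hc]

theorem ExplicitFormula.efficiency (h : Sh.ExplicitFormula) : Sh.Efficiency := by
  intro α G A _ _ v
  simp only [h α G A]
  rw [Finset.sum_comm]
  refine Finset.sum_congr rfl fun y _ => ?_
  rw [← Finset.sum_smul, sum_share, one_smul]

theorem ExplicitFormula.nullRoot (h : Sh.ExplicitFormula) : Sh.NullRoot := by
  intro α G A _ _ v r hr
  rw [h]
  refine Finset.sum_eq_zero fun y _ => ?_
  by_cases hy : y ∈ G.desc r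
  · rw [hr y hy, smul_zero]
  · rw [G.share_eq_zero hy, zero_smul]

end AssignmentRule

/-! ### Invariance of path counts and synergies under automorphisms -/

namespace DAMG.Automorphism

variable {α : Type u} {G : DAMG α} (φ : G.Automorphism)

theorem isPath_map {x y : G.verts} {l : List G.E} :
    G.IsPath (φ.onVerts x) (l.map φ.onEdges) (φ.onVerts y) ↔ G.IsPath x l y := by
  induction l generalizing x with
  | nil => exact φ.onVerts.injective.eq_iff
  | cons e l ih =>
    simp only [List.map_cons, IsPath, φ.tail_eq, φ.head_eq, ih, φ.onVerts.injective.eq_iff]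

theorem pathCount_map (x y : G.verts) :
    G.pathCount (φ.onVerts x) (φ.onVerts y) = G.pathCount x y := by
  have : G.paths (φ.onVerts x) (φ.onVerts y) = List.map φ.onEdges '' G.paths x y := by
    ext l
    constructor
    · intro h
      refine ⟨l.map φ.onEdges.symm, φ.isPath_map.1 ?_, ?_⟩
      · rw [List.map_map, φ.onEdges.self_comp_symm, List.map_id]
        exact h
      · simp
    · rintro ⟨m, hm, rfl⟩
      exact φ.isPath_map.2 hm
  rw [pathCount, this, Set.ncard_image_of_injective _ (List.map_injective_iff.2
    φ.onEdges.injective), pathCount]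

theorem onRoots_bijective : Function.Bijective φ.onRoots :=
  Function.Injective.bijective_of_finite fun _ _ h =>
    Subtype.ext (φ.onVerts.injective (congrArg Subtype.val h :))

theorem rootPathCount_map (y : G.verts) : G.rootPathCount (φ.onVerts y) = G.rootPathCount y :=
  (Fintype.sum_bijective φ.onRoots φ.onRoots_bijective _ _
    fun r => (φ.pathCount_map r y).symm).symm

theorem share_map (r : G.roots) (y : G.verts) :
    G.share (φ.onRoots r) (φ.onVerts y) = G.share r y :=
  Subtype.ext (congrArg₂ (fun a b : ℕ => (a : ℚ) / b) (φ.pathCount_map r y) (φ.rootPathCount_map y))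

theorem moebius_map {A : Type w} [AddCommGroup A] (v : G.verts → A) :
    G.moebius (fun y => v (φ.onVerts y)) = fun y => G.moebius v (φ.onVerts y) := by
  classical
  refine G.moebius_eq_of_sum fun x => ?_
  rw [← G.sum_moebius v, Finset.sum_filter, Finset.sum_filter, ← Equiv.sum_comp φ.onVerts
    (fun y => if y ∈ G.anc (φ.onVerts x) then G.moebius v y else 0)]
  simp only [mem_anc_iff, φ.pathCount_map]

end DAMG.Automorphism

namespace AssignmentRule
open DAMG

variable {Sh : AssignmentRule.{u, w}}

theorem ExplicitFormula.symmetry (h : Sh.ExplicitFormula) : Sh.Symmetry := by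
  intro α G A _ _ v φ r
  -- Reindexing by `φ` moves the automorphism from the shares to the synergies. The second claim
  -- then needs equal synergies only where the share of `r` can be nonzero.
  have key : Sh G A v (φ.onRoots r) = ∑ y, G.share r y • G.moebius v (φ.onVerts y) := by
    rw [h, ← Equiv.sum_comp φ.onVerts]
    simp only [φ.share_map]
  refine ⟨by rw [key, h, φ.moebius_map], fun hv => ?_⟩
  rw [key, h]
  refine Finset.sum_congr rfl fun y _ => ?_
  by_cases hy : y ∈ G.desc r
  · rw [hv y hy]
  · rw [G.share_eq_zero hy, zero_smul, zero_smul]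

/-! ### Uniqueness -/

/-- The weak vertices of the unanimity game are projected out until the hierarchy is flat. `ULift`
places the coefficient ring in the universe of the modules. -/
theorem unanimity_eq_share (h₁ : Sh.ALinearity) (h₂ : Sh.WeakElements) (h₃ : Sh.FlatHierarchy)
    {α : Type u} (G : DAMG α) (y : G.verts) (r : G.roots) :
    Sh G (ULift.{w} G.ring) (G.unanimity _ y) r = ULift.up (G.share r y) := by
  classical
  let W : Finset G.verts := {x | x ∉ G.roots ∧ x ≠ y}
  have hW : ∀ z ∈ W, z ∉ G.roots := fun z hz => (Finset.mem_filter.1 hz).2.1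
  have hy : y ∉ W := by simp [W]
  obtain ⟨y', hy'⟩ := G.incl_surjOn W hy
  let := G.projModule W hW (ULift.{w} G.ring)
  have hflat : (G.projOut W).HierarchicallyFlat := by
    intro x
    by_contra! hx
    have hroot : ∀ x ∉ (G.projOut W).roots, G.incl W x = y := fun x hx => by
      by_contra hne
      exact G.incl_notMem W x (by simp [W, hne, (G.mem_roots_projOut W hW).not.1 hx])
    -- The head of an edge is a non-root, and `y` is the only vertex that can survive as one; an
    -- edge leaving a non-root would therefore be a loop.
    refine hx.2 fun x' => Set.eq_empty_of_forall_notMem fun e he => ?_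
    have hx' : x' ∉ (G.projOut W).roots := ((G.projOut W).not_mem_roots_iff x').2 ⟨e, he.2⟩
    have := G.incl_injective W ((hroot x hx.1).trans (hroot x' hx').symm)
    exact (G.projOut W).tail_ne_head e (he.1.trans (this.trans he.2.symm))
  have hweak : Sh G (ULift.{w} G.ring) (G.unanimity _ y) r = Sh (G.projOut W) (ULift.{w} G.ring)
      (fun x => G.unanimity _ y (G.incl W x)) (G.rootLift W hW r) :=
    h₂ α G (ULift.{w} G.ring) _ W hW (fun z hz => by
      rw [IsWeak, moebius_unanimity]
      exact if_neg (Finset.mem_filter.1 hz).2.2) r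
  -- The flat axiom speaks of values in the smaller ring `ℤ_{G^{∖W}}`. `A`-linearity with the single
  -- element `1 ∈ ℤ_G` carries its result over to `ℤ_G`.
  let _ : Module (ULift.{w} (G.projOut W).ring) (ULift.{w} G.ring) := ULift.module
  have htower : IsScalarTower (G.projOut W).ring (ULift.{w} (G.projOut W).ring)
      (ULift.{w} G.ring) := ⟨fun a b c => mul_smul a b.down c⟩
  have hlin := h₁ α (G.projOut W) (ULift.{w} (G.projOut W).ring) (ULift.{w} G.ring) 1
    (fun _ => 1) (fun _ => (G.projOut W).unanimity _ y') (G.rootLift W hW r)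
  simp only [Finset.univ_unique, Finset.sum_singleton] at hlin
  have hval : Sh (G.projOut W) (ULift.{w} (G.projOut W).ring) ((G.projOut W).unanimity _ y')
      (G.rootLift W hW r) = ULift.up ((G.projOut W).share (G.rootLift W hW r) y') := by
    apply ULift.down_injective
    apply Subtype.ext
    rw [h₃ α _ hflat, hflat.coe_share]
  have hun : (fun x => G.unanimity (ULift.{w} G.ring) y (G.incl W x)) = fun x =>
      (G.projOut W).unanimity (ULift.{w} (G.projOut W).ring) y' x • (1 : ULift.{w} G.ring) := by
    funext x
    have : G.incl W x ∈ G.desc y ↔ x ∈ (G.projOut W).desc y' := by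
      rw [mem_desc_iff, mem_desc_iff, pathCount_projOut, hy']
    simp only [unanimity, this, ite_smul, one_smul, zero_smul]
  rw [hweak, hun, hlin, hval, ← hy', ← G.share_projOut W hW]
  apply ULift.down_injective
  exact mul_one _

/-- `A`-linearity is applied to the expansion of `v` in unanimity games, with the synergies as
module elements and the vertices enumerated by `Fin`. -/
theorem explicitFormula_of_axioms (h₁ : Sh.ALinearity) (h₂ : Sh.WeakElements)
    (h₃ : Sh.FlatHierarchy) : Sh.ExplicitFormula := by
  intro α G A _ _ v r
  have e := Fintype.equivFin G.verts
  have := h₁ α G (ULift.{w} G.ring) A (Fintype.card G.verts) (fun i => G.moebius v (e.symm i))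
    (fun i => G.unanimity _ (e.symm i)) r
  rw [Equiv.sum_comp e.symm fun y => Sh G _ (G.unanimity (ULift.{w} G.ring) y) r • G.moebius v y]
    at this
  simp only [unanimity_eq_share h₁ h₂ h₃] at this
  rw [← funext fun x => ((Equiv.sum_comp e.symm fun y => G.unanimity (ULift.{w} G.ring) y x •
    G.moebius v y).trans (G.sum_unanimity_smul v x)).symm] at this
  exact this
end AssignmentRule

namespace DAMG
variable {α : Type u}

/-! ### Hasse diagrams -/

/-- In a finite poset the order is the reflexive transitive closure of the covering relation. -/
theorem mem_anc_hasse [PartialOrder α] {s : Set α} {hs : s.Finite} {x y : s} :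
    y ∈ (hasse s hs).anc x ↔ y ≤ x := by
  classical
  constructor
  · rintro ⟨l, hl⟩
    replace hl : (hasse s hs).IsPath y l x := hl
    induction l generalizing y with
    | nil => exact le_of_eq hl
    | cons e l ih =>
      obtain ⟨rfl, h⟩ := hl
      exact e.2.1.le.trans (ih h)
  · intro h
    have : Fintype s := hs.fintype
    let _ : LocallyFiniteOrder s := Fintype.toLocallyFiniteOrder
    have h' := le_iff_reflTransGen_covBy.1 h
    induction h' using Relation.ReflTransGen.head_induction_on with
    | refl => exact mem_anc_self _ _
    | head hac hcb ih =>
      obtain ⟨l, hl⟩ := ih (le_iff_reflTransGen_covBy.2 hcb)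
      exact ⟨⟨(_, _), hac.1, fun ⟨z, h1, h2⟩ => hac.2 h1 h2⟩ :: l, rfl, hl⟩

/-! ### Path counts and synergies in Boolean lattices -/

section Boolean

variable {I : Type u}

theorem erase_ne_empty [DecidableEq I] {y : Finset I} (hy : 1 < y.card) (j : I) :
    y.erase j ≠ ∅ := fun h => by
  have := Finset.pred_card_le_card_erase (a := j) (s := y)
  rw [h, Finset.card_empty] at this
  omega

variable [Fintype I]

/-- The parents of a set `y` with at least two elements are the sets `y \ {j}` for `j ∈ y`. -/
theorem sum_nonemptySubsets_parents [DecidableEq I] {M : Type*} [AddCommMonoid M]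
    (f : (nonemptySubsets I).verts → M)
    (y : (nonemptySubsets I).verts) (hy : 1 < y.1.card)
    {dec : DecidablePred fun e => (nonemptySubsets I).head e = y} :
    ∑ e with (nonemptySubsets I).head e = y, f ((nonemptySubsets I).tail e) =
      ∑ j ∈ y.1, f ⟨y.1.erase j, erase_ne_empty hy j⟩ := by
  symm
  refine Finset.sum_bij (fun j hj => ⟨(⟨y.1.erase j, erase_ne_empty hy j⟩, y),
    (Finset.erase_ssubset hj : y.1.erase j < y.1), ?_⟩) ?_ ?_ ?_ ?_
  · rintro ⟨z, h1, h2⟩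
    have h1' : y.1.erase j ⊂ z.1 := h1
    have h2' : z.1 ⊂ y.1 := h2
    have := Finset.card_lt_card h1'
    have := Finset.card_lt_card h2'
    have := Finset.card_erase_of_mem hj
    omega
  · intro j hj
    exact Finset.mem_filter.2 ⟨Finset.mem_univ _, rfl⟩
  · intro j hj k hk h
    have h' : y.1.erase j = y.1.erase k := congrArg (fun e => ((nonemptySubsets I).tail e).1) h
    exact Finset.erase_injOn _ hj hk h'
  · rintro ⟨⟨a, b⟩, hab, hcov⟩ he
    obtain rfl : b = y := (Finset.mem_filter.1 he).2
    obtain ⟨j, hjb, hja⟩ := Finset.exists_of_ssubset (show a.1 ⊂ b.1 from hab)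
    have hsub : a.1 ⊆ b.1.erase j := fun k hk =>
      Finset.mem_erase.2 ⟨fun h => hja (h ▸ hk), hab.le hk⟩
    -- Otherwise `b \ {j}` would lie strictly between `a` and `b`.
    have heq : b.1.erase j = a.1 := by
      by_contra hne'
      exact hcov ⟨⟨b.1.erase j, erase_ne_empty hy j⟩,
        (Finset.ssubset_iff_subset_ne.2 ⟨hsub, Ne.symm hne'⟩ : a.1 < b.1.erase j),
        (Finset.erase_ssubset hjb : b.1.erase j < b.1)⟩
    exact ⟨j, hjb, Subtype.ext (Prod.ext (Subtype.ext heq) rfl)⟩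
  · intro j hj
    rfl

theorem mem_roots_nonemptySubsets {y : (nonemptySubsets I).verts} :
    y ∈ (nonemptySubsets I).roots ↔ y.1.card = 1 := by
  classical
  constructor
  · intro h
    by_contra hy
    have h0 : y.1.card ≠ 0 := Finset.card_ne_zero.2 (Finset.nonempty_iff_ne_empty.2 y.2)
    -- With the constant `1` this counts the incoming edges: there are `|y| ≠ 0` of them, but a root
    -- has none.
    have := sum_nonemptySubsets_parents (fun _ => 1) y (by omega) (dec := inferInstance)
    exact h0 ((Finset.card_eq_sum_ones _).trans (this.symm.trans (Finset.sum_eq_zero fun e he =>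
      absurd h ((not_mem_roots_iff _ _).2 ⟨e, (Finset.mem_filter.1 he).2⟩))))
  · intro h
    obtain ⟨i, hi⟩ := Finset.card_eq_one.1 h
    rw [show y = (player i : (nonemptySubsets I).verts) from Subtype.ext hi]
    exact (player i).2

/-- A path from a singleton to `y` amounts to an ordering of `y`. -/
theorem rootPathCount_nonemptySubsets (n : ℕ) (y : (nonemptySubsets I).verts)
    (hy : y.1.card = n + 1) : (nonemptySubsets I).rootPathCount y = (n + 1).factorial := by
  classical
  induction n generalizing y with
  | zero => exact (nonemptySubsets I).rootPathCount_root ⟨y, mem_roots_nonemptySubsets.2 hy⟩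
  | succ n ih =>
    rw [rootPathCount_eq_sum _ (mem_roots_nonemptySubsets.not.2 (by omega))]
    refine (sum_nonemptySubsets_parents
      (fun x => (nonemptySubsets I).rootPathCount x) y (by omega)).trans ?_
    rw [Finset.sum_congr rfl fun j hj => ih _ ?_,
      Finset.sum_const, hy, smul_eq_mul, ← Nat.factorial_succ]
    exact (Finset.card_erase_of_mem hj).trans (by omega)

-- A path from `{i}` to `y` amounts to an ordering of the `n` elements of `y` other than `i`.
open Classical in
theorem pathCount_player (i : I) (n : ℕ) (y : (nonemptySubsets I).verts)
    (hy : y.1.card = n + 1) :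
    (nonemptySubsets I).pathCount (player i) y = if i ∈ y.1 then n.factorial else 0 := by
  induction n generalizing y with
  | zero =>
    split_ifs with h
    · have : y = (player i : (nonemptySubsets I).verts) := Subtype.ext
        (Finset.card_eq_one.1 hy |>.elim fun k hk => by
          rw [hk, Finset.mem_singleton] at h
          rw [hk, ← h]
          rfl)
      rw [this, pathCount_self, Nat.factorial_zero]
    · refine pathCount_of_mem_roots _ (mem_roots_nonemptySubsets.2 hy) fun h' => h ?_
      rw [← h']
      exact Finset.mem_singleton_self i
  | succ n ih =>
    have hne : ((player i : (nonemptySubsets I).verts)) ≠ y := fun h => by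
      rw [← h] at hy
      have : ({i} : Finset I).card = n + 1 + 1 := hy
      simp at this
    have key : ∀ j ∈ y.1, (nonemptySubsets I).pathCount (player i)
        ⟨y.1.erase j, erase_ne_empty (by omega) j⟩ =
          if i ∈ y.1.erase j then n.factorial else 0 := fun j hj =>
      ih _ ((Finset.card_erase_of_mem hj).trans (by omega))
    rw [pathCount_eq_sum _ hne]
    refine (sum_nonemptySubsets_parents
      (fun x => (nonemptySubsets I).pathCount (player i) x) y (by omega)).trans ?_
    rw [Finset.sum_congr rfl key]
    split_ifs with h
    -- Of the `n + 2` parents `y \ {j}`, only the one with `j = i` misses `i`; the other `n + 1`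
    -- contribute `n!` each.
    · have h1 : Finset.filter (fun j => i ∈ y.1.erase j) y.1 = y.1.erase i := by
        ext j
        simp only [Finset.mem_filter, Finset.mem_erase, h, and_true, ne_comm (a := j)]
        exact and_comm
      rw [← Finset.sum_filter, h1, Finset.sum_const, Finset.card_erase_of_mem h, hy, smul_eq_mul,
        Nat.add_sub_cancel, Nat.factorial_succ]
    · exact Finset.sum_eq_zero fun j _ => if_neg fun hj => h (Finset.mem_of_mem_erase hj)

open Classical in
theorem coe_share_player (i : I) (y : (nonemptySubsets I).verts) :
    ((nonemptySubsets I).share (player i) y : ℚ) = if i ∈ y.1 then 1 / (y.1.card : ℚ) else 0 := by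
  obtain ⟨n, hn⟩ := Nat.exists_eq_succ_of_ne_zero
    (Finset.card_ne_zero.2 (Finset.nonempty_iff_ne_empty.2 y.2))
  rw [coe_share, pathCount_player i n y hn, rootPathCount_nonemptySubsets n y hn, hn]
  split_ifs
  · rw [Nat.factorial_succ]
    have : (n.factorial : ℚ) ≠ 0 := Nat.cast_ne_zero.2 n.factorial_ne_zero
    push_cast
    field_simp
  · simp

variable {A : Type w} [AddCommGroup A]

theorem sum_powerset_moebius_subsets (v : Finset I → A) (x : Finset I) :
    ∑ y ∈ x.powerset, (subsets I).moebius (fun z => v z.1) ⟨y, Set.mem_univ y⟩ = v x := by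
  classical
  rw [← (subsets I).sum_moebius (fun z => v z.1) ⟨x, Set.mem_univ x⟩]
  refine Finset.sum_bij (fun y _ => ⟨y, Set.mem_univ y⟩) (fun y hy => ?_)
    (fun y _ z _ h => congrArg Subtype.val h) (fun y hy => ?_) fun y _ => rfl
  · refine Finset.mem_filter.2 ⟨Finset.mem_univ _, ?_⟩
    exact mem_anc_hasse.2 (Finset.mem_powerset.1 hy)
  · exact ⟨y.1, Finset.mem_powerset.2 (mem_anc_hasse.1 (Finset.mem_filter.1 hy).2), rfl⟩

theorem moebius_subsets_empty (v : Finset I → A) :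
    (subsets I).moebius (fun z => v z.1) ⟨∅, Set.mem_univ ∅⟩ = v ∅ := by
  simpa using sum_powerset_moebius_subsets v ∅

/-- Deleting the bottom element drops only the synergy of `∅` from the ancestor sums, and this
equals `v ∅ = 0`. -/
theorem moebius_nonemptySubsets (v : Finset I → A) (hv : v ∅ = 0) :
    (nonemptySubsets I).moebius (fun y => v y.1) =
      fun y => (subsets I).moebius (fun z => v z.1) ⟨y.1, Set.mem_univ y.1⟩ := by
  classical
  refine (nonemptySubsets I).moebius_eq_of_sum fun x => ?_
  rw [← sum_powerset_moebius_subsets v x.1,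
    ← Finset.sum_erase _ (f := fun y : Finset I => (subsets I).moebius (fun z => v z.1)
      ⟨y, Set.mem_univ y⟩) ((moebius_subsets_empty v).trans hv)]
  refine Finset.sum_bij (fun y _ => y.1) (fun y hy => ?_) (fun y _ z _ h => Subtype.ext h)
    (fun y hy => ?_) fun y _ => rfl
  · exact Finset.mem_erase.2 ⟨y.2, Finset.mem_powerset.2
      (mem_anc_hasse.1 (Finset.mem_filter.1 hy).2)⟩
  · obtain ⟨h1, h2⟩ := Finset.mem_erase.1 hy
    exact ⟨⟨y, h1⟩, Finset.mem_filter.2 ⟨Finset.mem_univ _,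
      mem_anc_hasse.2 (Finset.mem_powerset.1 h2)⟩, rfl⟩

end Boolean

end DAMG

/-! ### Shapley's formula -/

/-- Each numerator equals `d! s! C(k+s, s)`, and the hockey-stick identity sums these binomials to
`C(d+s+1, s+1)`. -/
theorem sum_choose_mul_factorial (s d : ℕ) :
    ∑ k ∈ Finset.range (d + 1), (d.choose k : ℚ) *
      (((s + k).factorial * (d - k).factorial) / (s + d + 1).factorial) = 1 / (s + 1) := by
  have h : ∀ k ∈ Finset.range (d + 1), d.choose k * ((s + k).factorial * (d - k).factorial) =
      d.factorial * s.factorial * (k + s).choose s := by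
    intro k hk
    have h1 := Nat.choose_mul_factorial_mul_factorial (Nat.lt_succ_iff.1 (Finset.mem_range.1 hk))
    have h2 := Nat.add_choose_mul_factorial_mul_factorial k s
    rw [← h1, add_comm s k, ← h2]
    ring
  have h3 := Nat.add_choose_mul_factorial_mul_factorial d (s + 1)
  have h4 : ∑ k ∈ Finset.range (d + 1), d.choose k * ((s + k).factorial * (d - k).factorial) *
      (s + 1) = (s + d + 1).factorial := by
    rw [← Finset.sum_mul, Finset.sum_congr rfl h, ← Finset.mul_sum, Nat.sum_range_add_choose,
      show s + d + 1 = d + (s + 1) by ring, ← h3, add_assoc d, Nat.factorial_succ s]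
    ring
  have h5 : ((s + d + 1).factorial : ℚ) ≠ 0 := Nat.cast_ne_zero.2 (Nat.factorial_ne_zero _)
  have h6 : (s + 1 : ℚ) ≠ 0 := by positivity
  simp only [← mul_div_assoc]
  rw [← Finset.sum_div, div_eq_div_iff h5 h6, one_mul, ← h4, Finset.sum_mul]
  push_cast
  rfl

/-- In a random order of `N` and one further player, the summand is the probability that exactly `y`
precedes that player. The sum is the probability that all of `z` does, so that the player is last
among `|z| + 1`. The proof writes `y = z ∪ t` and groups by the size of `t`. -/
theorem sum_Icc_factorial {I : Type*} [DecidableEq I] {z N : Finset I} (h : z ⊆ N) :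
    ∑ y ∈ Finset.Icc z N, ((y.card.factorial * (N.card - y.card).factorial : ℚ) /
      (N.card + 1).factorial) = 1 / ((z.card : ℚ) + 1) := by
  obtain ⟨d, hd⟩ := Nat.exists_eq_add_of_le (Finset.card_le_card h)
  have hdisj : ∀ t ∈ (N \ z).powerset, Disjoint z t := fun t ht =>
    Finset.disjoint_of_subset_right (Finset.mem_powerset.1 ht) Finset.disjoint_sdiff
  rw [Finset.Icc_eq_image_powerset h, Finset.sum_image fun s hs t ht hst => ?_]
  · rw [← sum_choose_mul_factorial z.card d]
    have hcard : (N \ z).card = d := by rw [Finset.card_sdiff_of_subset h]; omega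
    rw [← hcard, Finset.sum_congr rfl fun t ht => ?_, Finset.sum_powerset_apply_card (fun k =>
      (((z.card + k).factorial * (d - k).factorial : ℚ) / (z.card + d + 1).factorial)), hcard]
    · simp only [nsmul_eq_mul]
    · rw [Finset.card_union_of_disjoint (hdisj t ht), hd, Nat.add_sub_add_left]
  · have h1 := Finset.union_sdiff_cancel_left (hdisj s hs)
    have h2 := Finset.union_sdiff_cancel_left (hdisj t ht)
    rw [← h1, ← h2]
    exact congrArg (· \ z) hst

open Classical in
/-- Shapley's two formulas agree: `w` is the synergy function of `v`. -/
theorem sum_div_card_eq_sum_marginal {I : Type*} [Fintype I] {A : Type*} [AddCommGroup A]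
    [Module ℚ A] (v w : Finset I → A) (h : ∀ x, ∑ y ∈ x.powerset, w y = v x) (i : I) :
    ∑ y : Finset I with i ∈ y, (1 / (y.card : ℚ)) • w y =
      ∑ y : Finset I with i ∉ y,
        ((y.card.factorial * (Fintype.card I - y.card - 1).factorial : ℚ) /
          (Fintype.card I).factorial) • (v (insert i y) - v y) := by
  set N : Finset I := Finset.univ.erase i with hN
  have hcard : Fintype.card I = N.card + 1 := by
    rw [hN, Finset.card_erase_add_one (Finset.mem_univ i), Finset.card_univ]
  have hmem : ∀ y : Finset I, i ∉ y ↔ y ⊆ N := fun y => by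
    simp [hN, Finset.subset_erase]
  -- The marginal contribution of `i` collects the synergies of those subsets of `insert i y` that
  -- contain `i`.
  have hdiff : ∀ y : Finset I, i ∉ y →
      v (insert i y) - v y = ∑ z ∈ y.powerset, w (insert i z) := fun y hy => by
    rw [← h, ← h, Finset.sum_powerset_insert hy, add_sub_cancel_left]
  have hfilter : Finset.univ.filter (fun y : Finset I => i ∉ y) = N.powerset := by
    ext y
    simp [hmem]
  have hL : ∑ y : Finset I with i ∈ y, (1 / (y.card : ℚ)) • w y =
      ∑ z ∈ N.powerset, (1 / ((z.card : ℚ) + 1)) • w (insert i z) := by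
    symm
    refine Finset.sum_bij (fun z _ => insert i z) (fun z _ => by simp) (fun a ha b hb hab => ?_)
      (fun y hy => ?_) fun z hz => ?_
    · have ha' := (hmem a).2 (Finset.mem_powerset.1 ha)
      have hb' := (hmem b).2 (Finset.mem_powerset.1 hb)
      rw [← Finset.erase_insert ha', hab, Finset.erase_insert hb']
    · have hy' := (Finset.mem_filter.1 hy).2
      exact ⟨y.erase i, Finset.mem_powerset.2 ((hmem _).1 (Finset.notMem_erase i y)),
        Finset.insert_erase hy'⟩
    · rw [Finset.card_insert_of_notMem ((hmem z).2 (Finset.mem_powerset.1 hz))]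
      push_cast
      rfl
  rw [hL, hfilter]
  have hR : ∀ y ∈ N.powerset,
      ((y.card.factorial * (Fintype.card I - y.card - 1).factorial : ℚ) /
        (Fintype.card I).factorial) • (v (insert i y) - v y) =
      ∑ z ∈ y.powerset, ((y.card.factorial * (N.card - y.card).factorial : ℚ) /
        (N.card + 1).factorial) • w (insert i z) := fun y hy => by
    rw [hdiff y ((hmem y).2 (Finset.mem_powerset.1 hy)), Finset.smul_sum, hcard,
      Nat.sub_right_comm, Nat.add_sub_cancel]
  -- After exchanging the sums, the coefficient of `w (insert i z)` runs over all `y` with `z ⊆ y ⊆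
  -- N`.
  rw [Finset.sum_congr rfl hR, Finset.sum_comm' (t' := N.powerset)
    (s' := fun z => Finset.Icc z N) fun y z => ?_]
  · refine Finset.sum_congr rfl fun z hz => ?_
    rw [← Finset.sum_smul, sum_Icc_factorial (Finset.mem_powerset.1 hz)]
  · simp only [Finset.mem_powerset, Finset.mem_Icc]
    exact ⟨fun ⟨h1, h2⟩ => ⟨⟨h2, h1⟩, h2.trans h1⟩, fun ⟨⟨h1, h2⟩, _⟩ => ⟨h2, h1⟩⟩

/-! ### Shapley's formulas for the rule, and the main theorem -/

namespace AssignmentRule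
open DAMG

variable {Sh : AssignmentRule.{u, w}}

theorem ExplicitFormula.recoversShapley (h : Sh.ExplicitFormula) : Sh.RecoversShapley := by
  classical
  intro I _ A _ _ v hv i
  have key : Sh (nonemptySubsets I) A (fun y => v y.1) (player i) =
      ∑ y : Finset I with i ∈ y, (1 / (y.card : ℚ)) •
        (subsets I).moebius (fun z => v z.1) ⟨y, Set.mem_univ y⟩ := by
    rw [h, moebius_nonemptySubsets v hv]
    simp only [Subring.smul_def, coe_share_player, ite_smul, zero_smul]
    rw [← Finset.sum_filter]
    refine Finset.sum_bij (fun y _ => y.1) (fun y hy => ?_) (fun y _ z _ h => Subtype.ext h)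
      (fun y hy => ?_) fun y _ => rfl
    · exact Finset.mem_filter.2 ⟨Finset.mem_univ _, (Finset.mem_filter.1 hy).2⟩
    · have hy' := (Finset.mem_filter.1 hy).2
      exact ⟨⟨y, Finset.ne_empty_of_mem hy'⟩, Finset.mem_filter.2 ⟨Finset.mem_univ _, hy'⟩, rfl⟩
  refine ⟨?_, ?_⟩
  · rw [key]
  · rw [key, sum_div_card_eq_sum_marginal v _ (sum_powerset_moebius_subsets v) i]

end AssignmentRule

/-- The three axioms force the explicit formula and the further properties, and conversely the rule
defined by the explicit formula has all these properties. -/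
theorem mainTheorem8 :
    (∀ Sh : AssignmentRule.{u, w},
      Sh.ALinearity → Sh.WeakElements → Sh.FlatHierarchy →
        Sh.ExplicitFormula ∧ Sh.PathUniformWeights ∧ AssignmentRule.RLinearity.{u, w, x} Sh ∧
        Sh.Efficiency ∧ Sh.NullRoot ∧ Sh.Projection ∧ Sh.Symmetry ∧ Sh.RecoversShapley) ∧
    (∀ Sh : AssignmentRule.{u, w},
      Sh.ExplicitFormula →
        Sh.ALinearity ∧ Sh.WeakElements ∧ Sh.FlatHierarchy ∧
        Sh.PathUniformWeights ∧ AssignmentRule.RLinearity.{u, w, x} Sh ∧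
        Sh.Efficiency ∧ Sh.NullRoot ∧ Sh.Projection ∧ Sh.Symmetry ∧ Sh.RecoversShapley) ∧
    AssignmentRule.ExplicitFormula (AssignmentRule.explicit.{u, w}) := by
  have key : ∀ Sh : AssignmentRule.{u, w}, Sh.ExplicitFormula →
      Sh.PathUniformWeights ∧ AssignmentRule.RLinearity.{u, w, x} Sh ∧ Sh.Efficiency ∧
        Sh.NullRoot ∧ Sh.Projection ∧ Sh.Symmetry ∧ Sh.RecoversShapley := fun _ h =>
    ⟨h.pathUniformWeights, h.rLinearity, h.efficiency, h.nullRoot, h.projection, h.symmetry,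
      h.recoversShapley⟩
  refine ⟨fun Sh h₁ h₂ h₃ => ?_, fun Sh h => ⟨h.aLinearity, h.weakElements, h.flatHierarchy,
    key Sh h⟩, fun _ _ _ _ _ _ _ => rfl⟩
  have h := AssignmentRule.explicitFormula_of_axioms h₁ h₂ h₃
  exact ⟨h, key Sh h⟩
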